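/- Let $n\ge 2$, let $B$ be the closed unit ball of $\mathbb R^n$ and let $\sigma$ be the surface measure of $\partial B$. Let $\alpha\in(0,1)$. For $E\subset\mathbb R^n$ let $$P_\alpha(E)=\int_E\int_{E^c}\frac{dx\,dy}{|x-y|^{n+\alpha}}$$ be its fractional $\alpha$-perimeter. For $u:\partial B\to\mathbb R$ put $E_u=\{\lambda(1+u(x))x:\lambda\in[0,1],\,x\in\partial B\}$ and $P_\alpha(u)=P_\alpha(E_u)$, and define the first and second variations $$\delta P_\alpha(u)[\varphi]=\frac{d}{ds}\Big|_{s=0}P_\alpha(u+s\varphi),\qquad \delta^2P_\alpha(u)[\varphi,\psi]=\frac{d}{dt}\Big|_{t=0}\delta P_\alpha(u+t\psi)[\varphi].$$ For $u\in C^1(\partial B)$ let $\|u\|_{C^1}=\sup_{\partial B}|u|+\sup_{\partial B}|\nabla_\tau u|$, where $\nabla_\tau$ is the tangential gradient, and let $$\|u\|^2_{H^{\frac{1+\alpha}2}}=\int_{\partial B}u^2\,d\sigma+\int_{\partial B\times\partial B}\frac{(u(x)-u(y))^2}{|x-y|^{n+\alpha}}\,d\sigma_x\,d\sigma_y .$$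 There exists a constant $C=C(n,\alpha)>0$ such that, for every $u\in C^1(\partial B)$ with $\|u\|_{C^1}<\frac12$, the second variations $\delta^2P_\alpha(\lambda u)[u,u]$, $|\lambda|\le1$, exist (with $P_\alpha$ finite at all the sets near $E_{\lambda u}$ that enter their definition), $$\left|\delta^2P_\alpha(u)[u,u]-\delta^2P_\alpha(0)[u,u]\right|\le C\,\|u\|_{C^1}\,\|u\|^2_{H^{\frac{1+\alpha}2}},$$ and, for every $\lambda\in\mathbb R$ with $|\lambda|\le1$, $$\left|\delta^2P_\alpha(\lambda u)[u,u]\right|\le C\,\|u\|^2_{H^{\frac{1+\alpha}2}}.$$ -/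

import Mathlib

open MeasureTheory Set Metric Filter Topology

open scoped ENNReal

noncomputable section

namespace FracPerimeter

/-- The Euclidean space `ℝⁿ`. -/
abbrev Space (n : ℕ) : Type := EuclideanSpace ℝ (Fin n)

/-- The unit sphere `∂B` of `ℝⁿ`. -/
abbrev Sph (n : ℕ) : Type := sphere (0 : Space n) 1

/-- The surface measure `σ` of `∂B`: the measure of `A ⊆ ∂B` is `n` times the volume of the
cone `(0,1) • A`. -/
abbrev surfaceMeasure (n : ℕ) : Measure (Sph n) := (volume : Measure (Space n)).toSphere

/-! ### The space `C¹(∂B)` and its norm -/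

/-- The extension `z ↦ u (z / |z|)` of `u : ∂B → ℝ`, constant along rays (value `0` at `0`). -/
def radialExt {n : ℕ} (u : Sph n → ℝ) (z : Space n) : ℝ :=
  open Classical in
  if h : z = 0 then 0
  else u ⟨‖z‖⁻¹ • z, by simp [norm_smul, h]⟩

/-- `u ∈ C¹(∂B)`. As `z ↦ z / |z|` is a smooth retraction of `ℝⁿ ∖ {0}` onto `∂B`, the function
`u` is of class `C¹` on the manifold `∂B` if and only if its extension constant along rays is of
class `C¹` on `ℝⁿ ∖ {0}` (see `isC1_iff_contMDiff`). -/
def IsC1 {n : ℕ} (u : Sph n → ℝ) : Prop :=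
  ContDiffOn ℝ 1 (radialExt u) {0}ᶜ

theorem radialExt_coe {n : ℕ} (u : Sph n → ℝ) (x : Sph n) : radialExt u (x : Space n) = u x := by
  have h : (x : Space n) ≠ 0 := ne_zero_of_mem_unit_sphere x
  have h1 : ‖(x : Space n)‖ = 1 := norm_eq_of_mem_sphere x
  simp only [radialExt, h, dite_false]
  congr 1
  ext1
  simp [h1]

open scoped Manifold ContDiff in
/-- `IsC1` is `C¹` regularity on the manifold `∂B`. -/
theorem isC1_iff_contMDiff {n m : ℕ} [Fact (Module.finrank ℝ (Space n) = m + 1)]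
    (u : Sph n → ℝ) : IsC1 u ↔ ContMDiff (𝓡 m) 𝓘(ℝ) 1 u := by
  constructor
  · intro h
    have h2 : ContMDiffOn 𝓘(ℝ, Space n) 𝓘(ℝ) 1 (radialExt u) {0}ᶜ := h.contMDiffOn
    have h3 : ContMDiff (𝓡 m) 𝓘(ℝ, Space n) 1 ((↑) : Sph n → Space n) := contMDiff_coe_sphere
    have h4 := h2.comp_contMDiff h3 (fun x => ne_zero_of_mem_unit_sphere x)
    have : radialExt u ∘ ((↑) : Sph n → Space n) = u := funext (radialExt_coe u)
    rwa [this] at h4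
  · intro h
    let U : TopologicalSpace.Opens (Space n) := ⟨{0}ᶜ, isOpen_compl_singleton⟩
    have hU : ∀ z : U, (z : Space n) ≠ 0 := fun z => z.2
    let f : U → Space n := fun z => ‖(z : Space n)‖⁻¹ • (z : Space n)
    have hf : ContMDiff 𝓘(ℝ, Space n) 𝓘(ℝ, Space n) 1 f := by
      intro z
      have : ContDiffAt ℝ 1 (fun z : Space n => ‖z‖⁻¹ • z) (z : Space n) :=
        ((contDiffAt_norm ℝ (hU z)).inv (norm_ne_zero_iff.2 (hU z))).smul contDiffAt_id
      exact (contMDiffAt_subtype_iff (U := U)).2 this.contMDiffAt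
    have hf' : ∀ z : U, f z ∈ sphere (0 : Space n) 1 := by
      intro z; simp [f, norm_smul, hU z]
    have h5 := h.comp (hf.codRestrict_sphere (n := m) hf')
    intro z hz
    have h6 := h5 ⟨z, hz⟩
    have h7 : (u ∘ Set.codRestrict f _ hf') = fun z : U => radialExt u (z : Space n) := by
      funext w
      simp [radialExt, hU w, f]
      rfl
    rw [h7] at h6
    exact ((contMDiffAt_subtype_iff (U := U) (x := ⟨z, hz⟩)).1 h6).contDiffAt.contDiffWithinAt

/-- `‖u‖_{C¹} = sup |u| + sup |∇_τ u|`. At a point of `∂B` the gradient of the extension constant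
along rays has no radial component: it is the tangential gradient `∇_τ u`. -/
def c1Norm {n : ℕ} (u : Sph n → ℝ) : ℝ :=
  (⨆ x : Sph n, |u x|) + ⨆ x : Sph n, ‖fderiv ℝ (radialExt u) (x : Space n)‖

/-! ### Fractional Sobolev norms on the sphere -/

/-- The squared Gagliardo seminorm
`[u]²_{H^β(∂B)} = ∫∫ (u(x) - u(y))² / |x - y|^(n - 1 + 2β) dσ_x dσ_y`. -/
def gagliardoSq {n : ℕ} (β : ℝ) (u : Sph n → ℝ) : ℝ :=
  ∫ p : Sph n × Sph n,
    (u p.1 - u p.2) ^ 2 / ‖(p.1 : Space n) - (p.2 : Space n)‖ ^ ((n : ℝ) - 1 + 2 * β)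
    ∂((surfaceMeasure n).prod (surfaceMeasure n))

/-- `‖u‖_{H^β(∂B)} = (‖u‖²_{L²(∂B)} + [u]²_{H^β(∂B)})^{1/2}`. -/
def sobolevNorm {n : ℕ} (β : ℝ) (u : Sph n → ℝ) : ℝ :=
  Real.sqrt ((∫ x, u x ^ 2 ∂(surfaceMeasure n)) + gagliardoSq β u)

/-! ### The fractional perimeter of nearly spherical sets -/

/-- `P_α(E) = ∫_E ∫_{Eᶜ} |x - y|^{-(n+α)} dy dx`, with values in `[0, ∞]`. -/
def perimeter {n : ℕ} (α : ℝ) (E : Set (Space n)) : ℝ≥0∞ :=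
  ∫⁻ x in E, ∫⁻ y in Eᶜ, ENNReal.ofReal (1 / ‖x - y‖ ^ ((n : ℝ) + α))

/-- `E_u = {λ (1 + u(x)) x : λ ∈ [0,1], x ∈ ∂B}`. -/
def nearlySpherical {n : ℕ} (u : Sph n → ℝ) : Set (Space n) :=
  {z | ∃ l ∈ Icc (0 : ℝ) 1, ∃ x : Sph n, z = (l * (1 + u x)) • (x : Space n)}

/-- `P_α(u) = P_α(E_u)` as a real number (meaningful when `P_α(E_u) < ∞`). -/
def perimeterOf {n : ℕ} (α : ℝ) (u : Sph n → ℝ) : ℝ :=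
  (perimeter α (nearlySpherical u)).toReal

/-! ### First and second variation -/

/-- `δP_α(u)[φ] = d/ds P_α(u + s φ)` at `s = 0`. -/
def firstVariation {n : ℕ} (α : ℝ) (u φ : Sph n → ℝ) : ℝ :=
  deriv (fun s : ℝ => perimeterOf α (u + s • φ)) 0

/-- `δ²P_α(u)[φ, ψ] = d/dt δP_α(u + t ψ)[φ]` at `t = 0`. -/
def secondVariation {n : ℕ} (α : ℝ) (u φ ψ : Sph n → ℝ) : ℝ :=
  deriv (fun t : ℝ => firstVariation α (u + t • ψ) φ) 0

/-- `δP_α(u)[φ]` exists: `P_α(u + s φ)` is finite for small `s` and differentiable at `s = 0`. -/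
def HasFirstVariation {n : ℕ} (α : ℝ) (u φ : Sph n → ℝ) : Prop :=
  (∀ᶠ s : ℝ in 𝓝 0, perimeter α (nearlySpherical (u + s • φ)) ≠ ∞) ∧
    DifferentiableAt ℝ (fun s : ℝ => perimeterOf α (u + s • φ)) 0

/-- `δ²P_α(u)[φ, ψ]` exists: `δP_α(u + t ψ)[φ]` exists for small `t` and is differentiable
at `t = 0`. -/
def HasSecondVariation {n : ℕ} (α : ℝ) (u φ ψ : Sph n → ℝ) : Prop :=
  (∀ᶠ t : ℝ in 𝓝 0, HasFirstVariation α (u + t • ψ) φ) ∧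
    DifferentiableAt ℝ (fun t : ℝ => firstVariation α (u + t • ψ) φ) 0

end FracPerimeter

end

/-! The second variation along `u` only sees the one-variable function `t ↦ P_α(t u)`, so everything
rests on a formula for that function which exhibits the quadratic smallness of the nonlocal part and
no longer contains a non-integrable singularity.

In polar coordinates, `P_α(w)` integrates a kernel `K(x, y, r, ρ)`, symmetric in `x, y`, over `r ≤
a`, `ρ > b`, with `a = 1 + w x` and `b = 1 + w y`. Symmetrizing in `x, y` and using the identity of
indicators `1{r ≤ a, ρ > b} + 1{r ≤ b, ρ > a} = 1{r ≤ a, ρ > a} + 1{r ≤ b, ρ > b} + 1{r, ρ both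
between a and b}` splits `2 P_α(w)` into two kinds of terms (`two_mul_perimeter_eq`). Those cut at a
single radius scale to `(1 + w x)^(n - α) Φ(x)`, where `Φ` is `spherePotential`, bounded because `α
< 1`. The last one becomes, after an affine change of both radii, `(w x - w y)²` times an average of
`K`.

For `w = t u`, the identity `|r x - ρ y|² = (r - ρ)² + r ρ |x - y|²` turns `K` into `G(t e) / |x -
y|^(n + α)`, with `G = modelKernel` smooth and `e = chordVector u` made of two heights and a slope.
Hence `P_α(t u) = ∫ (1 + t u)^(n - α) Φ + ½ ∫ t² G(t e) W`, where `W` is the Gagliardo density,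
integrable because `u` is Lipschitz.

If `‖u‖_{C¹} = ε < 1/2`, then `‖e‖ ≤ 2ε` and all arguments stay in a compact set where the
integrands are smooth, so one may differentiate twice under the integral
(`hasDerivAt_integral_twice`). The second derivatives of the integrands are at most constants times
`u²` and `W`, which gives the `H^{(1+α)/2}` bound. Their change from `t = 0` to `t = 1` gains a
factor `ε`: `(1 + u)^(n - α - 2) - 1`, `G(e) - G(0)` and the `t`-derivatives of `G(t e)` are all
`O(ε)`. -/

noncomputable section

namespace FracPerimeter

/-! ### Polar coordinates and integrals on the sphere -/

/-- Integration in polar coordinates. -/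
theorem lintegral_polar {n : ℕ} (hn : n ≠ 0) {f : Space n → ℝ≥0∞} (hf : Measurable f) :
    ∫⁻ z, f z = ∫⁻ x : Sph n, ∫⁻ r in Ioi (0 : ℝ),
      ENNReal.ofReal (r ^ (n - 1)) * f (r • (x : Space n)) ∂(volume : Measure ℝ)
        ∂(surfaceMeasure n) := by
  have : Nonempty (Fin n) := ⟨⟨0, Nat.pos_of_ne_zero hn⟩⟩
  have hmp := (volume : Measure (Space n)).measurePreserving_homeomorphUnitSphereProd
  have hd : Module.finrank ℝ (Space n) = n := by simp
  rw [hd] at hmp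
  have h1 : ∫⁻ z, f z = ∫⁻ z : ({0}ᶜ : Set (Space n)), f z
      ∂((volume : Measure (Space n)).comap Subtype.val) := by
    rw [lintegral_subtype_comap (measurableSet_singleton _).compl f, restrict_compl_singleton]
  have h2 : ∀ p : Sph n × Ioi (0 : ℝ),
      (((homeomorphUnitSphereProd (Space n)).symm p : ({0}ᶜ : Set (Space n))) : Space n)
        = p.2.1 • (p.1 : Space n) := fun p => rfl
  have hm : Measurable fun p : Sph n × Ioi (0 : ℝ) => f (p.2.1 • (p.1 : Space n)) := by
    fun_prop
  have h3 := hmp.lintegral_comp (f := fun p => f (p.2.1 • (p.1 : Space n))) hm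
  rw [h1]
  have h4 : ∀ z : ({0}ᶜ : Set (Space n)),
      f ((homeomorphUnitSphereProd (Space n) z).2.1 •
        ((homeomorphUnitSphereProd (Space n) z).1 : Space n)) = f z := by
    intro z
    rw [← h2, Homeomorph.symm_apply_apply]
  simp only [h4] at h3
  rw [h3, lintegral_prod _ hm.aemeasurable]
  congr 1
  ext x
  rw [Measure.volumeIoiPow, lintegral_withDensity_eq_lintegral_mul _ (by fun_prop) (by fun_prop),
    ← lintegral_subtype_comap measurableSet_Ioi]
  rfl

/-- Integration of radial functions. -/
theorem lintegral_radial {n : ℕ} (hn : n ≠ 0) {g : ℝ → ℝ≥0∞} (hg : Measurable g) :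
    ∫⁻ z : Space n, g ‖z‖ = (∫⁻ r in Ioi (0 : ℝ), ENNReal.ofReal (r ^ (n - 1)) * g r) *
      surfaceMeasure n univ := by
  rw [lintegral_polar hn (by fun_prop), ← lintegral_const]
  congr 1
  ext x
  refine setLIntegral_congr_fun measurableSet_Ioi fun r hr => ?_
  simp [norm_smul, abs_of_pos (mem_Ioi.1 hr)]

/-! ### Power kernels: tails, local integrability, Riesz potentials -/

theorem lintegral_norm_rpow_compl_ball {n : ℕ} (hn : n ≠ 0) {α δ : ℝ} (hα : 0 < α) (hδ : 0 < δ) :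
    ∫⁻ z in {z : Space n | δ ≤ ‖z‖}, ENNReal.ofReal (1 / ‖z‖ ^ ((n : ℝ) + α)) =
      ENNReal.ofReal (δ ^ (-α) / α) * surfaceMeasure n univ := by
  have hm : MeasurableSet {z : Space n | δ ≤ ‖z‖} := measurableSet_le (by fun_prop) (by fun_prop)
  have := lintegral_radial hn
    (g := (Ici δ).indicator fun r => ENNReal.ofReal (1 / r ^ ((n : ℝ) + α)))
    (Measurable.indicator (by fun_prop) measurableSet_Ici)
  rw [← lintegral_indicator hm]
  have e : ∀ z : Space n, {z : Space n | δ ≤ ‖z‖}.indicator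
      (fun z => ENNReal.ofReal (1 / ‖z‖ ^ ((n : ℝ) + α))) z =
      (Ici δ).indicator (fun r => ENNReal.ofReal (1 / r ^ ((n : ℝ) + α))) ‖z‖ := fun z => by
    simp [indicator]
  simp only [e]
  rw [this]
  congr 1
  have e2 : ∀ r ∈ Ioi (0 : ℝ), ENNReal.ofReal (r ^ (n - 1)) *
      (Ici δ).indicator (fun r => ENNReal.ofReal (1 / r ^ ((n : ℝ) + α))) r =
      (Ici δ).indicator (fun r => ENNReal.ofReal (r ^ (-1 - α))) r := by
    intro r hr
    have hr : 0 < r := hr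
    by_cases h : δ ≤ r
    · simp only [indicator, mem_Ici, h, if_true]
      rw [← ENNReal.ofReal_mul (by positivity)]
      congr 1
      rw [one_div, ← Real.rpow_neg hr.le, ← Real.rpow_natCast, ← Real.rpow_add hr]
      congr 1
      rw [Nat.cast_sub (Nat.one_le_iff_ne_zero.2 hn)]
      push_cast; ring
    · simp [indicator, h]
  rw [setLIntegral_congr_fun measurableSet_Ioi e2, setLIntegral_indicator measurableSet_Ici,
    inter_eq_left.2 (show Ici δ ⊆ Ioi 0 from fun r hr => hδ.trans_le hr),
    ← restrict_Ioi_eq_restrict_Ici, ← ofReal_integral_eq_lintegral_ofReal]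
  · rw [integral_Ioi_rpow_of_lt (by linarith) hδ]
    congr 1
    rw [show -1 - α + 1 = -α by ring]
    field_simp
  · exact integrableOn_Ioi_rpow_of_lt (by linarith) hδ
  · filter_upwards [ae_restrict_mem measurableSet_Ioi] with r hr
    have : 0 < r := hδ.trans hr
    positivity

theorem lintegral_norm_rpow_ball_lt_top {n : ℕ} (hn : n ≠ 0) {s R : ℝ} (hs : s < n) :
    ∫⁻ z in {z : Space n | ‖z‖ ≤ R}, ENNReal.ofReal (1 / ‖z‖ ^ s) < ∞ := by
  have hm : MeasurableSet {z : Space n | ‖z‖ ≤ R} := measurableSet_le (by fun_prop) (by fun_prop)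
  have := lintegral_radial hn
    (g := (Iic R).indicator fun r => ENNReal.ofReal (1 / r ^ s))
    (Measurable.indicator (by fun_prop) measurableSet_Iic)
  rw [← lintegral_indicator hm]
  have e : ∀ z : Space n, {z : Space n | ‖z‖ ≤ R}.indicator
      (fun z => ENNReal.ofReal (1 / ‖z‖ ^ s)) z =
      (Iic R).indicator (fun r => ENNReal.ofReal (1 / r ^ s)) ‖z‖ := fun z => by
    simp [indicator]
  simp only [e]
  rw [this]
  refine ENNReal.mul_lt_top ?_ (measure_lt_top _ _)
  have e2 : ∀ r ∈ Ioi (0 : ℝ), ENNReal.ofReal (r ^ (n - 1)) *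
      (Iic R).indicator (fun r => ENNReal.ofReal (1 / r ^ s)) r =
      (Iic R).indicator (fun r => ENNReal.ofReal (r ^ (n - 1 - s))) r := by
    intro r hr
    have hr : 0 < r := hr
    by_cases h : r ≤ R
    · simp only [indicator, mem_Iic, h, if_true]
      rw [← ENNReal.ofReal_mul (by positivity)]
      congr 1
      rw [one_div, ← Real.rpow_neg hr.le, ← Real.rpow_natCast, ← Real.rpow_add hr]
      congr 1
      rw [Nat.cast_sub (Nat.one_le_iff_ne_zero.2 hn)]
      push_cast; ring
    · simp [indicator, h]
  rw [setLIntegral_congr_fun measurableSet_Ioi e2, setLIntegral_indicator measurableSet_Iic,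
    inter_comm, Ioi_inter_Iic]
  rcases le_or_gt R 0 with hR | hR
  · simp [Ioc_eq_empty_of_le hR]
  refine IntegrableOn.setLIntegral_lt_top ?_
  rw [← intervalIntegrable_iff_integrableOn_Ioc_of_le hR.le]
  exact intervalIntegral.intervalIntegrable_rpow' (by linarith)

theorem lintegral_one_sub_rpow_lt_top {α : ℝ} (hα : α < 1) :
    ∫⁻ r in Ioo (0 : ℝ) 1, ENNReal.ofReal ((1 - r) ^ (-α)) < ∞ := by
  refine IntegrableOn.setLIntegral_lt_top ?_
  rw [← integrableOn_Ioc_iff_integrableOn_Ioo,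
    ← intervalIntegrable_iff_integrableOn_Ioc_of_le zero_le_one]
  have := (intervalIntegral.intervalIntegrable_rpow' (a := 0) (b := 1)
    (show -1 < -α by linarith)).comp_sub_left 1
  simpa using this.symm

/-- The exterior of the unit ball lies outside the ball of radius `1 - r` centred at `r x`, so the
tail integral of the kernel bounds the left side. The resulting power `(1 - r)^(-α)` is integrable
up to `r = 1` exactly because `α < 1`. -/
theorem lintegral_kernel_compl_ball_le {n : ℕ} (hn : n ≠ 0) {α r : ℝ} (hα : 0 < α) (hr0 : 0 < r)
    (hr1 : r < 1) (x : Sph n) :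
    ∫⁻ z in {z : Space n | 1 < ‖z‖}, ENNReal.ofReal (1 / ‖r • (x : Space n) - z‖ ^ ((n : ℝ) + α)) ≤
      ENNReal.ofReal ((1 - r) ^ (-α)) * (ENNReal.ofReal α⁻¹ * surfaceMeasure n univ) := by
  have hx : ‖(x : Space n)‖ = 1 := norm_eq_of_mem_sphere x
  have hm : MeasurableSet {z : Space n | 1 - r ≤ ‖z‖} :=
    measurableSet_le (by fun_prop) (by fun_prop)
  have hm' : MeasurableSet {z : Space n | 1 < ‖z‖} :=
    measurableSet_lt (by fun_prop) (by fun_prop)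
  have key := lintegral_norm_rpow_compl_ball hn hα (sub_pos.2 hr1)
  rw [← mul_assoc, ← ENNReal.ofReal_mul (by have := sub_pos.2 hr1; positivity), ← div_eq_mul_inv,
    ← key, ← lintegral_indicator hm, ← lintegral_indicator hm',
    ← lintegral_sub_left_eq_self ({z : Space n | 1 - r ≤ ‖z‖}.indicator _) (r • (x : Space n))]
  refine lintegral_mono fun z => ?_
  refine indicator_apply_le' (fun hz => ?_) fun _ => zero_le
  have hz : 1 < ‖z‖ := hz
  have h : 1 - r ≤ ‖r • (x : Space n) - z‖ := by
    have h1 := norm_sub_norm_le z (r • (x : Space n))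
    rw [norm_smul, hx, Real.norm_of_nonneg hr0.le, norm_sub_rev] at h1
    linarith
  rw [indicator_of_mem (show _ ∈ {z : Space n | 1 - r ≤ ‖z‖} from h)]

/-- Riesz potentials of order less than `n - 1` are bounded on the sphere. -/
theorem exists_lintegral_sphere_rpow_le {n : ℕ} (hn : n ≠ 0) {s : ℝ} (hs0 : 0 < s)
    (hs : s < n - 1) : ∃ C : ℝ≥0∞, C < ∞ ∧ ∀ x : Sph n,
      ∫⁻ y : Sph n, ENNReal.ofReal (1 / ‖(x : Space n) - y‖ ^ s) ∂(surfaceMeasure n) ≤ C := by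
  -- The integral over the sphere is compared with a volume integral of exponent `s + 1 < n`. With
  -- `θ = |x - y|`, each `y` is thickened to the radii `r ∈ (1, 1 + θ)`, on which `|x - r y| ≤ 2θ ≤
  -- 4`; this explains the radius `4` and the factor `2^(s + 1)`.
  refine ⟨ENNReal.ofReal (2 ^ (s + 1)) * _, ENNReal.mul_lt_top ENNReal.ofReal_lt_top
    (lintegral_norm_rpow_ball_lt_top hn (s := s + 1) (R := 4) (by linarith)), fun x => ?_⟩
  have hx : ‖(x : Space n)‖ = 1 := norm_eq_of_mem_sphere x
  have hm : MeasurableSet {z : Space n | ‖z‖ ≤ 4} :=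
    measurableSet_le (by fun_prop) (by fun_prop)
  rw [← lintegral_indicator hm, ← lintegral_sub_left_eq_self _ (x : Space n), lintegral_polar hn,
    ← lintegral_const_mul' _ _ ENNReal.ofReal_ne_top]
  swap
  · exact (Measurable.indicator (by fun_prop) hm).comp (by fun_prop)
  refine lintegral_mono fun y => ?_
  have hy : ‖(y : Space n)‖ = 1 := norm_eq_of_mem_sphere y
  dsimp only
  set θ := ‖(x : Space n) - y‖ with hθ
  rcases (norm_nonneg ((x : Space n) - y)).eq_or_lt with h0 | h0
  -- At `y = x` the integrand has the default value `1 / 0 = 0`.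
  · rw [hθ, ← h0, Real.zero_rpow hs0.ne']; simp
  rw [← hθ] at h0
  have hθ2 : θ ≤ 2 := by
    have := norm_sub_le (x : Space n) y
    linarith
  calc ENNReal.ofReal (1 / θ ^ s)
      = ENNReal.ofReal (2 ^ (s + 1)) *
        ∫⁻ r in Ioo (1 : ℝ) (1 + θ), ENNReal.ofReal (1 / (2 * θ) ^ (s + 1)) := by
        rw [setLIntegral_const, Real.volume_Ioo, add_sub_cancel_left,
          ← ENNReal.ofReal_mul (by positivity), ← ENNReal.ofReal_mul (by positivity)]
        congr 1
        rw [Real.mul_rpow (by norm_num) h0.le, Real.rpow_add h0, Real.rpow_one]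
        field_simp
    _ ≤ _ := by
      refine mul_le_mul' le_rfl ?_
      refine (setLIntegral_mono' measurableSet_Ioo fun r hr => ?_).trans
        (lintegral_mono_set (show Ioo 1 (1 + θ) ⊆ Ioi 0 from fun r hr => zero_lt_one.trans hr.1))
      have h1 : ‖(x : Space n) - r • (y : Space n)‖ ≤ 2 * θ := by
        have e : (x : Space n) - r • (y : Space n) = (x - y) - (r - 1) • (y : Space n) := by
          module
        rw [e]
        refine (norm_sub_le _ _).trans ?_
        rw [norm_smul, hy, Real.norm_of_nonneg (by linarith [hr.1])]
        linarith [hr.2]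
      have h2 : 0 < ‖(x : Space n) - r • (y : Space n)‖ := by
        have := norm_sub_norm_le (r • (y : Space n)) x
        rw [norm_smul, hy, hx, Real.norm_of_nonneg (by linarith [hr.1]), norm_sub_rev] at this
        linarith [hr.1]
      rw [indicator_of_mem (show _ ∈ {z : Space n | ‖z‖ ≤ 4} from h1.trans (by linarith))]
      refine le_mul_of_one_le_of_le (by simpa using one_le_pow₀ hr.1.le) ?_
      gcongr

/-- The kernel `|z - w|^{-(n+α)}` in polar coordinates `z = r x`, `w = ρ y`, including the
Jacobians. -/
def polarKernel {n : ℕ} (α : ℝ) (x y : Sph n) (r ρ : ℝ) : ℝ :=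
  r ^ (n - 1) * ρ ^ (n - 1) / ‖r • (x : Space n) - ρ • (y : Space n)‖ ^ ((n : ℝ) + α)

/-- Separates the radial increment from the distance on the sphere. It gives the symmetry of the
kernel in `x, y` and the factorization through `modelKernel`. -/
theorem norm_smul_sub_smul_sq {n : ℕ} (x y : Sph n) (r ρ : ℝ) :
    ‖r • (x : Space n) - ρ • (y : Space n)‖ ^ 2 =
      (r - ρ) ^ 2 + r * ρ * ‖(x : Space n) - y‖ ^ 2 := by
  have hx : ‖(x : Space n)‖ = 1 := norm_eq_of_mem_sphere x
  have hy : ‖(y : Space n)‖ = 1 := norm_eq_of_mem_sphere y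
  rw [norm_sub_sq_real, norm_sub_sq_real, inner_smul_left, inner_smul_right, norm_smul, norm_smul,
    hx, hy, mul_pow, mul_pow]
  simp only [Real.norm_eq_abs, sq_abs, conj_trivial]
  ring

theorem polarKernel_comm {n : ℕ} (α : ℝ) (x y : Sph n) (r ρ : ℝ) :
    polarKernel α x y r ρ = polarKernel α y x r ρ := by
  have : ‖r • (x : Space n) - ρ • (y : Space n)‖ = ‖r • (y : Space n) - ρ • (x : Space n)‖ := by
    rw [← sq_eq_sq₀ (norm_nonneg _) (norm_nonneg _), norm_smul_sub_smul_sq, norm_smul_sub_smul_sq,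
      norm_sub_rev (x : Space n)]
  rw [polarKernel, polarKernel, this]

theorem measurable_polarKernel {n : ℕ} {α : ℝ} {X : Type*} [MeasurableSpace X] {x y : X → Sph n}
    {r ρ : X → ℝ} (hx : Measurable x) (hy : Measurable y) (hr : Measurable r) (hρ : Measurable ρ) :
    Measurable fun p => polarKernel α (x p) (y p) (r p) (ρ p) := by
  unfold polarKernel
  fun_prop

/-- Homogeneity: the two Jacobians contribute degree `2(n - 1)` and the denominator `-(n + α)`. The
factor `a ^ 2` anticipates the change of variables in `dr dρ`. -/
theorem polarKernel_smul {n : ℕ} (hn : n ≠ 0) (α : ℝ) (x y : Sph n) {a : ℝ} (ha : 0 < a)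
    (r ρ : ℝ) :
    a ^ 2 * polarKernel α x y (a * r) (a * ρ) = a ^ ((n : ℝ) - α) * polarKernel α x y r ρ := by
  have h : ‖(a * r) • (x : Space n) - (a * ρ) • (y : Space n)‖ =
      a * ‖r • (x : Space n) - ρ • (y : Space n)‖ := by
    rw [mul_smul, mul_smul, ← smul_sub, norm_smul, Real.norm_of_nonneg ha.le]
  have e : a ^ ((n : ℝ) - α) * a ^ ((n : ℝ) + α) = a ^ 2 * (a ^ (n - 1) * a ^ (n - 1)) := by
    rw [← Real.rpow_add ha, ← pow_add, ← pow_add, ← Real.rpow_natCast]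
    congr 1
    obtain ⟨m, rfl⟩ := Nat.exists_eq_succ_of_ne_zero hn
    push_cast [Nat.succ_sub_one]
    ring
  rw [polarKernel, polarKernel, h, Real.mul_rpow ha.le (norm_nonneg _), mul_pow, mul_pow]
  have hpos : 0 < a ^ ((n : ℝ) + α) := by positivity
  have e' : a ^ ((n : ℝ) - α) = a ^ 2 * (a ^ (n - 1) * a ^ (n - 1)) / a ^ ((n : ℝ) + α) := by
    rw [← e]; field_simp
  rw [e', mul_div_assoc', div_mul_div_comm]
  congr 1
  ring

/-! ### Nearly spherical sets -/

/-- The condition `-1 < w` makes every boundary radius positive, so a point at positive distance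
from the origin lies on the ray of only one `x`. -/
theorem smul_mem_nearlySpherical {n : ℕ} {w : Sph n → ℝ} (hw : ∀ x, -1 < w x) {r : ℝ} (hr : 0 < r)
    (x : Sph n) : r • (x : Space n) ∈ nearlySpherical w ↔ r ≤ 1 + w x := by
  constructor
  · rintro ⟨l, ⟨hl0, hl1⟩, y, hy⟩
    have hyw : 0 < 1 + w y := by linarith [hw y]
    have hn := congrArg norm hy
    rw [norm_smul, norm_smul, norm_eq_of_mem_sphere x, norm_eq_of_mem_sphere y,
      Real.norm_of_nonneg hr.le, Real.norm_of_nonneg (by positivity), mul_one, mul_one] at hn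
    rw [← hn] at hy
    have hxy : x = y := Subtype.ext (smul_right_injective _ hr.ne' hy)
    rw [hn, hxy]
    nlinarith
  · intro h
    have hyw : 0 < 1 + w x := by linarith [hw x]
    refine ⟨r / (1 + w x), ⟨by positivity, (div_le_one hyw).2 h⟩, x, ?_⟩
    rw [div_mul_cancel₀ _ hyw.ne']

theorem measurableSet_nearlySpherical {n : ℕ} {w : Sph n → ℝ} (hw : Continuous w) :
    MeasurableSet (nearlySpherical w) := by
  have : nearlySpherical w = (fun p : ℝ × Sph n => (p.1 * (1 + w p.2)) • (p.2 : Space n)) ''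
      (Icc (0 : ℝ) 1 ×ˢ univ) := by
    ext z
    constructor
    · rintro ⟨l, hl, x, rfl⟩
      exact ⟨(l, x), ⟨hl, mem_univ _⟩, rfl⟩
    · rintro ⟨⟨l, x⟩, ⟨hl, -⟩, rfl⟩
      exact ⟨l, hl, x, rfl⟩
  rw [this]
  exact ((isCompact_Icc.prod isCompact_univ).image (by fun_prop)).measurableSet

/-! ### The perimeter in polar coordinates -/

/-- The integral over `∂B × ∂B × (0, ∞) × (0, ∞)`. -/
def polarIntegral (n : ℕ) (F : Sph n → Sph n → ℝ → ℝ → ℝ≥0∞) : ℝ≥0∞ :=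
  ∫⁻ x, ∫⁻ y, ∫⁻ r in Ioi (0 : ℝ), ∫⁻ ρ in Ioi (0 : ℝ), F x y r ρ
    ∂volume ∂volume ∂(surfaceMeasure n) ∂(surfaceMeasure n)

/-- Joint measurability of a function of four variables. -/
def Measurable₄ {n : ℕ} (F : Sph n → Sph n → ℝ → ℝ → ℝ≥0∞) : Prop :=
  Measurable fun p : (Sph n × Sph n) × ℝ × ℝ => F p.1.1 p.1.2 p.2.1 p.2.2

theorem Measurable₄.comp {n : ℕ} {F : Sph n → Sph n → ℝ → ℝ → ℝ≥0∞} (hF : Measurable₄ F)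
    {X : Type*} [MeasurableSpace X] {x y : X → Sph n} {r ρ : X → ℝ} (hx : Measurable x)
    (hy : Measurable y) (hr : Measurable r) (hρ : Measurable ρ) :
    Measurable fun p => F (x p) (y p) (r p) (ρ p) :=
  Measurable.comp (g := fun p : (Sph n × Sph n) × ℝ × ℝ => F p.1.1 p.1.2 p.2.1 p.2.2) hF
    ((hx.prodMk hy).prodMk (hr.prodMk hρ))

theorem Measurable₄.lintegral₂ {n : ℕ} {F : Sph n → Sph n → ℝ → ℝ → ℝ≥0∞} (hF : Measurable₄ F)
    (ν : Measure ℝ) [SFinite ν] :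
    Measurable fun p : Sph n × Sph n => ∫⁻ r, ∫⁻ ρ, F p.1 p.2 r ρ ∂ν ∂ν := by
  refine Measurable.lintegral_prod_right' (f := fun q : (Sph n × Sph n) × ℝ =>
    ∫⁻ ρ, F q.1.1 q.1.2 q.2 ρ ∂ν) ?_
  exact Measurable.lintegral_prod_right' (f := fun q : ((Sph n × Sph n) × ℝ) × ℝ =>
    F q.1.1.1 q.1.1.2 q.1.2 q.2) (hF.comp (by fun_prop) (by fun_prop) (by fun_prop) (by fun_prop))

theorem polarIntegral_eq_lintegral_prod {n : ℕ} {F : Sph n → Sph n → ℝ → ℝ → ℝ≥0∞}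
    (hF : Measurable₄ F) :
    polarIntegral n F = ∫⁻ p : (Sph n × Sph n) × ℝ × ℝ, F p.1.1 p.1.2 p.2.1 p.2.2
      ∂(((surfaceMeasure n).prod (surfaceMeasure n)).prod
        ((volume.restrict (Ioi 0)).prod (volume.restrict (Ioi 0)))) := by
  rw [lintegral_prod _ (Measurable.aemeasurable hF), lintegral_prod _
    (Measurable.lintegral_prod_right' hF).aemeasurable]
  unfold polarIntegral
  congr 1
  ext x
  congr 1
  ext y
  rw [lintegral_prod]
  exact (hF.comp (by fun_prop) (by fun_prop) (by fun_prop) (by fun_prop)).aemeasurable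

theorem polarIntegral_swap {n : ℕ} {F : Sph n → Sph n → ℝ → ℝ → ℝ≥0∞} (hF : Measurable₄ F) :
    polarIntegral n (fun x y => F y x) = polarIntegral n F := by
  unfold polarIntegral
  rw [lintegral_lintegral_swap]
  exact ((hF.lintegral₂ _).comp measurable_swap).aemeasurable

theorem polarIntegral_add {n : ℕ} {F G : Sph n → Sph n → ℝ → ℝ → ℝ≥0∞} (hF : Measurable₄ F)
    (hG : Measurable₄ G) :
    polarIntegral n (fun x y r ρ => F x y r ρ + G x y r ρ) =
      polarIntegral n F + polarIntegral n G := by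
  rw [polarIntegral_eq_lintegral_prod hF, polarIntegral_eq_lintegral_prod hG,
    polarIntegral_eq_lintegral_prod (F := fun x y r ρ => F x y r ρ + G x y r ρ) (hF.add hG),
    lintegral_add_left hF]

theorem polarIntegral_congr {n : ℕ} {F G : Sph n → Sph n → ℝ → ℝ → ℝ≥0∞}
    (h : ∀ x y r ρ, 0 < r → 0 < ρ → F x y r ρ = G x y r ρ) :
    polarIntegral n F = polarIntegral n G := by
  unfold polarIntegral
  congr! 2 with x
  congr! 2 with y
  refine setLIntegral_congr_fun measurableSet_Ioi fun r hr => ?_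
  exact setLIntegral_congr_fun measurableSet_Ioi fun ρ hρ => h x y r ρ hr hρ

open Classical in
/-- The polar kernel restricted to pairs of radii. -/
def cutKernel {n : ℕ} (α : ℝ) (P : Sph n → Sph n → ℝ → ℝ → Prop) (x y : Sph n) (r ρ : ℝ) :
    ℝ≥0∞ :=
  if P x y r ρ then ENNReal.ofReal (polarKernel α x y r ρ) else 0

theorem measurable₄_cutKernel {n : ℕ} {α : ℝ} {P : Sph n → Sph n → ℝ → ℝ → Prop}
    (hP : MeasurableSet {p : (Sph n × Sph n) × ℝ × ℝ | P p.1.1 p.1.2 p.2.1 p.2.2}) :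
    Measurable₄ (cutKernel α P) :=
  Measurable.ite hP (measurable_polarKernel (by fun_prop) (by fun_prop) (by fun_prop)
    (by fun_prop)).ennreal_ofReal measurable_const

open Classical in
theorem lintegral_kernel_polar {n : ℕ} (hn : n ≠ 0) (α : ℝ) {A : Set (Space n)}
    (hA : MeasurableSet A) (x : Sph n) {r : ℝ} (hr : 0 < r) :
    ENNReal.ofReal (r ^ (n - 1)) *
        ∫⁻ z in A, ENNReal.ofReal (1 / ‖r • (x : Space n) - z‖ ^ ((n : ℝ) + α)) =
      ∫⁻ y, ∫⁻ ρ in Ioi (0 : ℝ), (if ρ • (y : Space n) ∈ A then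
        ENNReal.ofReal (polarKernel α x y r ρ) else 0) ∂volume ∂(surfaceMeasure n) := by
  rw [← lintegral_indicator hA, lintegral_polar hn (Measurable.indicator (by fun_prop) hA),
    ← lintegral_const_mul' _ _ ENNReal.ofReal_ne_top]
  congr! 2 with y
  rw [← lintegral_const_mul' _ _ ENNReal.ofReal_ne_top]
  refine setLIntegral_congr_fun measurableSet_Ioi fun ρ hρ => ?_
  have hρ : 0 < ρ := hρ
  by_cases h : ρ • (y : Space n) ∈ A
  · simp only [h, indicator_of_mem, if_true]
    rw [← ENNReal.ofReal_mul (by positivity), ← ENNReal.ofReal_mul (by positivity), polarKernel]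
    congr 1
    ring
  · simp [h]

theorem perimeter_eq_polarIntegral {n : ℕ} (hn : n ≠ 0) (α : ℝ) {w : Sph n → ℝ}
    (hwc : Continuous w) (hw : ∀ x, -1 < w x) :
    perimeter α (nearlySpherical w) =
      polarIntegral n (cutKernel α fun x y r ρ => r ≤ 1 + w x ∧ 1 + w y < ρ) := by
  have hE := measurableSet_nearlySpherical hwc
  have hM : Measurable₄ (cutKernel α fun x y r ρ => r ≤ 1 + w x ∧ 1 + w y < ρ) :=
    measurable₄_cutKernel (by measurability)
  unfold perimeter
  rw [← lintegral_indicator hE, lintegral_polar hn]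
  swap
  · refine Measurable.indicator ?_ hE
    exact Measurable.lintegral_prod_right' (f := fun p : Space n × Space n =>
      ENNReal.ofReal (1 / ‖p.1 - p.2‖ ^ ((n : ℝ) + α))) (by fun_prop)
  unfold polarIntegral
  congr! 2 with x
  rw [lintegral_lintegral_swap]
  swap
  · exact (Measurable.lintegral_prod_right' (f := fun p : (Sph n × ℝ) × ℝ => cutKernel α
      (fun x y r ρ => r ≤ 1 + w x ∧ 1 + w y < ρ) x p.1.1 p.1.2 p.2)
      (hM.comp (by fun_prop) (by fun_prop) (by fun_prop) (by fun_prop))).aemeasurable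
  refine setLIntegral_congr_fun measurableSet_Ioi fun r hr => ?_
  have hr : 0 < r := hr
  by_cases h : r ≤ 1 + w x
  · rw [indicator_of_mem ((smul_mem_nearlySpherical hw hr x).2 h),
      lintegral_kernel_polar hn α hE.compl x hr]
    congr! 2 with y
    refine setLIntegral_congr_fun measurableSet_Ioi fun ρ hρ => ?_
    simp only [cutKernel, h, true_and, mem_compl_iff, smul_mem_nearlySpherical hw hρ, not_le]
  · rw [indicator_of_notMem (fun h' => h ((smul_mem_nearlySpherical hw hr x).1 h'))]
    simp [cutKernel, h]

/-! ### The perimeter formula -/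

theorem setLIntegral_Ioi_comp_mul_left {a : ℝ} (ha : 0 < a) (g : ℝ → ℝ≥0∞) :
    ∫⁻ r in Ioi (0 : ℝ), g r = ∫⁻ r in Ioi (0 : ℝ), ENNReal.ofReal a * g (a * r) := by
  have h := lintegral_image_eq_lintegral_abs_deriv_mul (s := Ioi (0 : ℝ)) (f := fun r => a * r)
    (f' := fun _ => a) measurableSet_Ioi
    (fun x _ => by simpa using ((hasDerivAt_id x).const_mul a).hasDerivWithinAt)
    (mul_right_injective₀ ha.ne').injOn g
  rw [abs_of_pos ha] at h
  rw [← h, image_mul_left_Ioi ha, mul_zero]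

/-- Affine parametrization of the interval between `b` and `a`, whichever is larger, always starting
at `b`. The change of variables is made on open intervals, which differ from the half-open ones by
null sets. -/
theorem setLIntegral_uIoc_eq (a b : ℝ) (g : ℝ → ℝ≥0∞) :
    ∫⁻ r in uIoc b a, g r =
      ∫⁻ ξ in Ioc (0 : ℝ) 1, ENNReal.ofReal |a - b| * g (b + ξ * (a - b)) := by
  rcases eq_or_ne a b with rfl | hab
  · simp
  have hab' : a - b ≠ 0 := sub_ne_zero.2 hab
  have h := lintegral_image_eq_lintegral_abs_deriv_mul (s := Ioo (0 : ℝ) 1)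
    (f := fun ξ => b + ξ * (a - b)) (f' := fun _ => a - b) measurableSet_Ioo
    (fun x _ => by
      simpa using (((hasDerivAt_id x).mul_const (a - b)).const_add b).hasDerivWithinAt)
    (fun x _ y _ hxy => by simpa [hab'] using hxy) g
  have him : (fun ξ => b + ξ * (a - b)) '' Ioo (0 : ℝ) 1 = Ioo (min b a) (max b a) := by
    rcases lt_or_gt_of_ne hab with h | h
    · rw [min_eq_right h.le, max_eq_left h.le]
      refine Subset.antisymm ?_ fun r hr => ⟨(r - b) / (a - b), ⟨div_pos_of_neg_of_neg
        (sub_neg.2 hr.2) (sub_neg.2 h), (div_lt_one_of_neg (sub_neg.2 h)).2 (by linarith [hr.1])⟩,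
        by field_simp; ring⟩
      rintro _ ⟨ξ, ⟨h0, h1⟩, rfl⟩
      constructor <;> dsimp only <;> nlinarith
    · rw [min_eq_left h.le, max_eq_right h.le]
      refine Subset.antisymm ?_ fun r hr => ⟨(r - b) / (a - b), ⟨div_pos
        (sub_pos.2 hr.1) (sub_pos.2 h), (div_lt_one (sub_pos.2 h)).2 (by linarith [hr.2])⟩,
        by field_simp; ring⟩
      rintro _ ⟨ξ, ⟨h0, h1⟩, rfl⟩
      constructor <;> dsimp only <;> nlinarith
  rw [him] at h
  rw [uIoc, ← restrict_Ioo_eq_restrict_Ioc, ← restrict_Ioo_eq_restrict_Ioc, h]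

/-- The interaction of `x ∈ ∂B` with all of `∂B` when the radii are cut at `1`; its integral over
`∂B` is the perimeter of the ball. -/
def spherePotential {n : ℕ} (α : ℝ) (x : Sph n) : ℝ≥0∞ :=
  ∫⁻ y, ∫⁻ r in Ioi (0 : ℝ), ∫⁻ ρ in Ioi (0 : ℝ),
    cutKernel α (fun _ _ r ρ => r ≤ 1 ∧ 1 < ρ) x y r ρ ∂volume ∂volume ∂(surfaceMeasure n)

/-- Both radii are cut at the same value `1 + w x`, so rescaling them by it reduces to the cut at
`1`, and homogeneity of the kernel produces the power `n - α`. -/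
theorem lintegral_cutKernel_self {n : ℕ} (hn : n ≠ 0) (α : ℝ) (w : Sph n → ℝ) (x y : Sph n)
    (hx : -1 < w x) :
    ∫⁻ r in Ioi (0 : ℝ), ∫⁻ ρ in Ioi (0 : ℝ),
        cutKernel α (fun x _ r ρ => r ≤ 1 + w x ∧ 1 + w x < ρ) x y r ρ =
      ENNReal.ofReal ((1 + w x) ^ ((n : ℝ) - α)) * ∫⁻ r in Ioi (0 : ℝ), ∫⁻ ρ in Ioi (0 : ℝ),
        cutKernel α (fun _ _ r ρ => r ≤ 1 ∧ 1 < ρ) x y r ρ := by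
  set a := 1 + w x with ha
  have ha0 : 0 < a := by linarith
  rw [setLIntegral_Ioi_comp_mul_left ha0, ← lintegral_const_mul' _ _ ENNReal.ofReal_ne_top]
  congr! 2 with r
  rw [setLIntegral_Ioi_comp_mul_left ha0, ← lintegral_const_mul' _ _ ENNReal.ofReal_ne_top,
    ← lintegral_const_mul' _ _ ENNReal.ofReal_ne_top]
  congr! 2 with ρ
  have h1 : a * r ≤ a ↔ r ≤ 1 := mul_le_iff_le_one_right ha0
  have h2 : a < a * ρ ↔ 1 < ρ := lt_mul_iff_one_lt_right ha0
  simp only [cutKernel, ← ha, h1, h2]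
  split_ifs
  · rw [← ENNReal.ofReal_mul ha0.le, ← ENNReal.ofReal_mul ha0.le,
      ← ENNReal.ofReal_mul (by positivity), ← polarKernel_smul hn α x y ha0]
    congr 1
    ring
  · simp

theorem polarIntegral_cutKernel_self {n : ℕ} (hn : n ≠ 0) (α : ℝ) {w : Sph n → ℝ}
    (hw : ∀ x, -1 < w x) :
    polarIntegral n (cutKernel α fun x _ r ρ => r ≤ 1 + w x ∧ 1 + w x < ρ) =
      ∫⁻ x, ENNReal.ofReal ((1 + w x) ^ ((n : ℝ) - α)) * spherePotential α x
        ∂(surfaceMeasure n) := by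
  unfold polarIntegral spherePotential
  congr! 2 with x
  rw [← lintegral_const_mul' _ _ ENNReal.ofReal_ne_top]
  congr! 2 with y
  exact lintegral_cutKernel_self hn α w x y (hw x)

theorem lintegral_cutKernel_uIoc {n : ℕ} (α : ℝ) (w : Sph n → ℝ) (x y : Sph n)
    (hx : -1 < w x) (hy : -1 < w y) :
    ∫⁻ r in Ioi (0 : ℝ), ∫⁻ ρ in Ioi (0 : ℝ),
        cutKernel α (fun x y r ρ => r ∈ uIoc (1 + w y) (1 + w x) ∧
          ρ ∈ uIoc (1 + w y) (1 + w x)) x y r ρ =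
      ∫⁻ ξ in Ioc (0 : ℝ) 1, ∫⁻ η in Ioc (0 : ℝ) 1, ENNReal.ofReal ((w x - w y) ^ 2 *
        polarKernel α x y (1 + (w y + ξ * (w x - w y))) (1 + (w y + η * (w x - w y)))) := by
  have hsub : uIoc (1 + w y) (1 + w x) ⊆ Ioi (0 : ℝ) := fun r hr =>
    (lt_min (by linarith) (by linarith)).trans hr.1
  have key : ∀ g : ℝ → ℝ≥0∞, ∫⁻ r in Ioi (0 : ℝ), (uIoc (1 + w y) (1 + w x)).indicator g r =
      ∫⁻ ξ in Ioc (0 : ℝ) 1, ENNReal.ofReal |w x - w y| * g (1 + (w y + ξ * (w x - w y))) := by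
    intro g
    rw [setLIntegral_indicator measurableSet_uIoc, inter_eq_left.2 hsub, setLIntegral_uIoc_eq]
    simp only [add_sub_add_left_eq_sub, add_assoc]
  have h1 : ∀ r ρ, cutKernel α
      (fun x y r ρ => r ∈ uIoc (1 + w y) (1 + w x) ∧ ρ ∈ uIoc (1 + w y) (1 + w x)) x y r ρ =
      (uIoc (1 + w y) (1 + w x)).indicator (fun r => (uIoc (1 + w y) (1 + w x)).indicator
        (fun ρ => ENNReal.ofReal (polarKernel α x y r ρ)) ρ) r := by
    intro r ρ
    by_cases hr : r ∈ uIoc (1 + w y) (1 + w x) <;> by_cases hρ : ρ ∈ uIoc (1 + w y) (1 + w x) <;>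
      simp [cutKernel, hr, hρ]
  have h2 : ∀ r, ∫⁻ ρ in Ioi (0 : ℝ), cutKernel α
      (fun x y r ρ => r ∈ uIoc (1 + w y) (1 + w x) ∧ ρ ∈ uIoc (1 + w y) (1 + w x)) x y r ρ =
      (uIoc (1 + w y) (1 + w x)).indicator (fun r => ∫⁻ ρ in Ioi (0 : ℝ),
        (uIoc (1 + w y) (1 + w x)).indicator
        (fun ρ => ENNReal.ofReal (polarKernel α x y r ρ)) ρ) r := by
    intro r
    simp only [h1]
    by_cases hr : r ∈ uIoc (1 + w y) (1 + w x) <;> simp [hr]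
  simp only [h2]
  rw [key]
  congr! 2 with ξ
  rw [key, ← lintegral_const_mul' _ _ ENNReal.ofReal_ne_top]
  congr! 2 with η
  rw [← mul_assoc, ← ENNReal.ofReal_mul (abs_nonneg _), ← ENNReal.ofReal_mul (by positivity),
    abs_mul_abs_self, sq]

/-- The central decomposition. It keeps no difference of divergent quantities: all terms are
nonnegative, so it holds in `[0, ∞]` before finiteness is known. -/
theorem two_mul_perimeter_eq {n : ℕ} (hn : n ≠ 0) (α : ℝ) {w : Sph n → ℝ}
    (hwc : Continuous w) (hw : ∀ x, -1 < w x) :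
    2 * perimeter α (nearlySpherical w) =
      2 * ∫⁻ x, ENNReal.ofReal ((1 + w x) ^ ((n : ℝ) - α)) * spherePotential α x
        ∂(surfaceMeasure n) +
      ∫⁻ x, ∫⁻ y, ∫⁻ ξ in Ioc (0 : ℝ) 1, ∫⁻ η in Ioc (0 : ℝ) 1,
        ENNReal.ofReal ((w x - w y) ^ 2 *
          polarKernel α x y (1 + (w y + ξ * (w x - w y))) (1 + (w y + η * (w x - w y))))
        ∂volume ∂volume ∂(surfaceMeasure n) ∂(surfaceMeasure n) := by
  set F : Sph n → Sph n → ℝ → ℝ → ℝ≥0∞ :=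
    cutKernel α fun x y r ρ => r ≤ 1 + w x ∧ 1 + w y < ρ with hFdef
  set G : Sph n → Sph n → ℝ → ℝ → ℝ≥0∞ :=
    cutKernel α fun x _ r ρ => r ≤ 1 + w x ∧ 1 + w x < ρ with hGdef
  set J : Sph n → Sph n → ℝ → ℝ → ℝ≥0∞ := cutKernel α fun x y r ρ =>
    r ∈ uIoc (1 + w y) (1 + w x) ∧ ρ ∈ uIoc (1 + w y) (1 + w x) with hJdef
  have hF : Measurable₄ F := measurable₄_cutKernel (by measurability)
  have hG : Measurable₄ G := measurable₄_cutKernel (by measurability)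
  have hJ : Measurable₄ J := by
    refine measurable₄_cutKernel ?_
    simp only [uIoc, mem_Ioc]
    measurability
  have hF' : Measurable₄ fun x y => F y x :=
    hF.comp (by fun_prop) (by fun_prop) (by fun_prop) (by fun_prop)
  have hG' : Measurable₄ fun x y => G y x :=
    hG.comp (by fun_prop) (by fun_prop) (by fun_prop) (by fun_prop)
  have hJe : polarIntegral n J = ∫⁻ x, ∫⁻ y, ∫⁻ ξ in Ioc (0 : ℝ) 1, ∫⁻ η in Ioc (0 : ℝ) 1,
        ENNReal.ofReal ((w x - w y) ^ 2 *
          polarKernel α x y (1 + (w y + ξ * (w x - w y))) (1 + (w y + η * (w x - w y))))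
        ∂volume ∂volume ∂(surfaceMeasure n) ∂(surfaceMeasure n) := by
    unfold polarIntegral
    congr! 2 with x
    congr! 2 with y
    exact lintegral_cutKernel_uIoc α w x y (hw x) (hw y)
  rw [perimeter_eq_polarIntegral hn α hwc hw, ← polarIntegral_cutKernel_self hn α hw, ← hJe,
    two_mul, two_mul]
  -- One of the two copies on each side is replaced by its version with `x` and `y` exchanged, after
  -- which the identity holds pointwise.
  nth_rw 2 [← polarIntegral_swap hF]
  nth_rw 2 [← polarIntegral_swap hG]
  rw [← polarIntegral_add hF hF', ← polarIntegral_add hG hG',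
    ← polarIntegral_add (F := fun x y r ρ => G x y r ρ + G y x r ρ) (hG.add hG') hJ]
  refine polarIntegral_congr fun x y r ρ _ _ => ?_
  have hk := polarKernel_comm α x y r ρ
  have hI : ∀ s, s ∈ uIoc (1 + w y) (1 + w x) ↔
      (1 + w y < s ∧ s ≤ 1 + w x) ∨ (1 + w x < s ∧ s ≤ 1 + w y) := fun s => mem_uIoc
  simp only [hFdef, hGdef, hJdef, cutKernel, hI, ← hk, ← not_le]
  -- The indicator identity, checked on all positions of `r` and `ρ` relative to the two cuts; the
  -- inconsistent positions are excluded by order.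
  by_cases h1 : r ≤ 1 + w x <;> by_cases h2 : r ≤ 1 + w y <;> by_cases h3 : ρ ≤ 1 + w x <;>
    by_cases h4 : ρ ≤ 1 + w y <;> simp [h1, h2, h3, h4] <;> exfalso <;> linarith

/-- For fixed `x`, integrating over `y` and `ρ` first gives the integral of the kernel over the
exterior of the ball, seen from `r x`. It is at most a constant times `(1 - r)^(-α)`, whose integral
over `(0, 1)` is finite. -/
theorem exists_spherePotential_le {n : ℕ} (hn : n ≠ 0) {α : ℝ} (hα0 : 0 < α) (hα1 : α < 1) :
    ∃ C : ℝ≥0∞, C < ∞ ∧ ∀ x : Sph n, spherePotential α x ≤ C := by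
  refine ⟨(∫⁻ r in Ioo (0 : ℝ) 1, ENNReal.ofReal ((1 - r) ^ (-α))) *
    (ENNReal.ofReal α⁻¹ * surfaceMeasure n univ), ENNReal.mul_lt_top
    (lintegral_one_sub_rpow_lt_top hα1) (ENNReal.mul_lt_top ENNReal.ofReal_lt_top
    (measure_lt_top _ _)), fun x => ?_⟩
  have hM : Measurable₄ (n := n) (cutKernel α fun _ _ r ρ => r ≤ 1 ∧ 1 < ρ) :=
    measurable₄_cutKernel (by measurability)
  have hA : MeasurableSet {z : Space n | 1 < ‖z‖} := measurableSet_lt (by fun_prop) (by fun_prop)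
  unfold spherePotential
  rw [lintegral_lintegral_swap]
  swap
  · exact (Measurable.lintegral_prod_right' (f := fun p : (Sph n × ℝ) × ℝ => cutKernel α
      (fun _ _ r ρ => r ≤ 1 ∧ 1 < ρ) x p.1.1 p.1.2 p.2)
      (hM.comp (by fun_prop) (by fun_prop) (by fun_prop) (by fun_prop))).aemeasurable
  rw [← lintegral_mul_const' _ _ (ENNReal.mul_lt_top ENNReal.ofReal_lt_top
    (measure_lt_top _ _)).ne, restrict_Ioo_eq_restrict_Ioc]
  have hsub : Ioc (0 : ℝ) 1 = Iic 1 ∩ Ioi 0 := by rw [inter_comm, Ioi_inter_Iic]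
  rw [hsub, ← setLIntegral_indicator measurableSet_Iic]
  have h1 : ∀ᵐ r : ℝ ∂(volume.restrict (Ioi 0)), r ≠ 1 :=
    ae_restrict_of_ae (by simp [ae_iff])
  refine lintegral_mono_ae ?_
  filter_upwards [h1, ae_restrict_mem measurableSet_Ioi] with r hr1 hr
  have hr : 0 < r := hr
  by_cases h : r ≤ 1
  · rw [indicator_of_mem (show r ∈ Iic 1 from h)]
    refine le_trans ?_ (lintegral_kernel_compl_ball_le hn hα0 hr (lt_of_le_of_ne h hr1) x)
    refine le_trans ?_ (mul_le_of_le_one_left zero_le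
      (show ENNReal.ofReal (r ^ (n - 1)) ≤ 1 by simpa using pow_le_one₀ hr.le h))
    rw [lintegral_kernel_polar hn α hA x hr]
    refine le_of_eq ?_
    congr! 2 with y
    refine setLIntegral_congr_fun measurableSet_Ioi fun ρ hρ => ?_
    have : ‖ρ • (y : Space n)‖ = ρ := by
      rw [norm_smul, norm_eq_of_mem_sphere y, mul_one, Real.norm_of_nonneg (le_of_lt hρ)]
    simp only [cutKernel, h, true_and, mem_ofPred_eq, this]
  · simp [cutKernel, h]

/-! ### Differentiation under the integral sign -/

theorem exists_bound_fderiv_comp_smul {E F : Type*} [NormedAddCommGroup E] [NormedSpace ℝ E]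
    [NormedAddCommGroup F] [NormedSpace ℝ F] {f : E → F} {U K : Set E} (hU : IsOpen U)
    (hf : ContDiffOn ℝ 1 f U) (hK : IsCompact K) (hKU : K ⊆ U) :
    ∃ C : ℝ, 0 ≤ C ∧ ∀ (e : E) (t : ℝ), t • e ∈ K →
      HasDerivAt (fun t : ℝ => f (t • e)) (fderiv ℝ f (t • e) e) t ∧
      ‖f (t • e)‖ ≤ C ∧ ‖fderiv ℝ f (t • e) e‖ ≤ C * ‖e‖ := by
  have h1 : ContDiffOn ℝ 0 (fderiv ℝ f) U := hf.fderiv_of_isOpen hU (by norm_num)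
  obtain ⟨C0, hC0⟩ := hK.exists_bound_of_continuousOn (hf.continuousOn.mono hKU)
  obtain ⟨C1, hC1⟩ := hK.exists_bound_of_continuousOn (h1.continuousOn.mono hKU)
  refine ⟨max 0 (max C0 C1), le_max_left _ _, fun e t ht => ⟨?_, ?_, ?_⟩⟩
  · have hray : HasDerivAt (fun t : ℝ => t • e) e t := by
      simpa using (hasDerivAt_id t).smul_const e
    exact ((hf.contDiffAt (hU.mem_nhds (hKU ht))).differentiableAt
      (by norm_num)).hasFDerivAt.comp_hasDerivAt t hray
  · exact (hC0 _ ht).trans (by simp)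
  · exact (ContinuousLinearMap.le_opNorm _ _).trans
      (mul_le_mul_of_nonneg_right ((hC1 _ ht).trans (by simp)) (norm_nonneg _))

/-- Derivatives along rays of a `C²` function, with bounds on a compact set. -/
theorem exists_bound_hasDerivAt_comp_smul {E : Type*} [NormedAddCommGroup E] [NormedSpace ℝ E]
    {H : E → ℝ} {U K : Set E} (hU : IsOpen U) (hH : ContDiffOn ℝ 2 H U) (hK : IsCompact K)
    (hKU : K ⊆ U) :
    ∃ C : ℝ, 0 ≤ C ∧ ∀ (e : E) (t : ℝ), t • e ∈ K →
      HasDerivAt (fun t : ℝ => H (t • e)) (fderiv ℝ H (t • e) e) t ∧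
      HasDerivAt (fun t : ℝ => fderiv ℝ H (t • e) e) (fderiv ℝ (fderiv ℝ H) (t • e) e e) t ∧
      |H (t • e)| ≤ C ∧ |fderiv ℝ H (t • e) e| ≤ C * ‖e‖ ∧
      |fderiv ℝ (fderiv ℝ H) (t • e) e e| ≤ C * ‖e‖ ^ 2 := by
  obtain ⟨C0, hC0, h0⟩ := exists_bound_fderiv_comp_smul hU (hH.of_le (by norm_num)) hK hKU
  obtain ⟨C1, hC1, h1⟩ := exists_bound_fderiv_comp_smul hU
    (hH.fderiv_of_isOpen (m := 1) hU (by norm_num)) hK hKU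
  refine ⟨max C0 C1, hC0.trans (le_max_left _ _), fun e t ht => ?_⟩
  obtain ⟨a1, a2, a3⟩ := h0 e t ht
  obtain ⟨b1, -, b3⟩ := h1 e t ht
  refine ⟨a1, ?_, a2.trans (le_max_left _ _),
    a3.trans (mul_le_mul_of_nonneg_right (le_max_left _ _) (norm_nonneg _)), ?_⟩
  · simpa using b1.clm_apply (hasDerivAt_const t e)
  · refine ((fderiv ℝ (fderiv ℝ H) (t • e) e).le_opNorm e).trans ?_
    rw [sq, ← mul_assoc]
    exact mul_le_mul_of_nonneg_right (b3.trans
      (mul_le_mul_of_nonneg_right (le_max_right _ _) (norm_nonneg _))) (norm_nonneg _)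

/-- The derivative is a pointwise limit of difference quotients along a sequence. This gives
measurability of derivatives known only through `HasDerivAt`. -/
theorem measurable_of_hasDerivAt {M : Type*} [MeasurableSpace M] {F : ℝ → M → ℝ} {F' : M → ℝ}
    {s : Set ℝ} {t : ℝ} (hs : s ∈ 𝓝 t) (hF : ∀ t ∈ s, Measurable (F t))
    (hd : ∀ m, HasDerivAt (fun t => F t m) (F' m) t) : Measurable F' := by
  have hlim : Tendsto (fun k : ℕ => t + 1 / ((k : ℝ) + 1)) atTop (𝓝 t) := by
    simpa using (tendsto_one_div_add_atTop_nhds_zero_nat (𝕜 := ℝ)).const_add t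
  have hlim' : Tendsto (fun k : ℕ => t + 1 / ((k : ℝ) + 1)) atTop (𝓝[≠] t) := by
    refine tendsto_nhdsWithin_iff.2 ⟨hlim, Eventually.of_forall fun k => ?_⟩
    have : (0 : ℝ) < 1 / ((k : ℝ) + 1) := by positivity
    simpa using this.ne'
  obtain ⟨N, hN⟩ := eventually_atTop.1 (hlim.eventually hs)
  refine measurable_of_tendsto_metrizable
    -- The shift by `N` keeps every sampled time in `s`, where `F` is measurable.
    (f := fun (k : ℕ) m => slope (fun t => F t m) t (t + 1 / (((k + N : ℕ) : ℝ) + 1))) ?_ ?_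
  · intro k
    simp only [slope_def_field]
    exact ((hF _ (hN (k + N) (Nat.le_add_left _ _))).sub (hF _ (mem_of_mem_nhds hs))).div_const _
  · rw [tendsto_pi_nhds]
    intro m
    exact ((hasDerivAt_iff_tendsto_slope.1 (hd m)).comp hlim').comp (tendsto_add_atTop_nat N)

/-- Differentiating twice under the integral sign. -/
theorem hasDerivAt_integral_twice {M : Type*} [MeasurableSpace M] {μ : Measure M}
    {F F' F'' : ℝ → M → ℝ} {b : M → ℝ} {s : Set ℝ} (hs : IsOpen s) (hb : Integrable b μ)
    (hF : ∀ t ∈ s, Measurable (F t))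
    (hd : ∀ t ∈ s, ∀ m, HasDerivAt (fun t => F t m) (F' t m) t)
    (hd' : ∀ t ∈ s, ∀ m, HasDerivAt (fun t => F' t m) (F'' t m) t)
    (h0 : ∀ t ∈ s, ∀ m, |F t m| ≤ b m) (h1 : ∀ t ∈ s, ∀ m, |F' t m| ≤ b m)
    (h2 : ∀ t ∈ s, ∀ m, |F'' t m| ≤ b m) {t : ℝ} (ht : t ∈ s) :
    Integrable (F t) μ ∧ Integrable (F'' t) μ ∧
      HasDerivAt (fun t => ∫ m, F t m ∂μ) (∫ m, F' t m ∂μ) t ∧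
      HasDerivAt (fun t => ∫ m, F' t m ∂μ) (∫ m, F'' t m ∂μ) t := by
  have hF' : ∀ t ∈ s, Measurable (F' t) := fun t ht =>
    measurable_of_hasDerivAt (hs.mem_nhds ht) hF (hd t ht)
  have hF'' : ∀ t ∈ s, Measurable (F'' t) := fun t ht =>
    measurable_of_hasDerivAt (hs.mem_nhds ht) hF' (hd' t ht)
  have i0 : Integrable (F t) μ := hb.mono' (hF t ht).aestronglyMeasurable
    (Eventually.of_forall fun m => h0 t ht m)
  have i1 : Integrable (F' t) μ := hb.mono' (hF' t ht).aestronglyMeasurable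
    (Eventually.of_forall fun m => h1 t ht m)
  have i2 : Integrable (F'' t) μ := hb.mono' (hF'' t ht).aestronglyMeasurable
    (Eventually.of_forall fun m => h2 t ht m)
  refine ⟨i0, i2, ?_, ?_⟩
  · refine (hasDerivAt_integral_of_dominated_loc_of_deriv_le (hs.mem_nhds ht) ?_ i0
      (hF' t ht).aestronglyMeasurable ?_ hb ?_).2
    · filter_upwards [hs.mem_nhds ht] with x hx using (hF x hx).aestronglyMeasurable
    · exact Eventually.of_forall fun m t ht => h1 t ht m
    · exact Eventually.of_forall fun m t ht => hd t ht m
  · refine (hasDerivAt_integral_of_dominated_loc_of_deriv_le (hs.mem_nhds ht) ?_ i1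
      (hF'' t ht).aestronglyMeasurable ?_ hb ?_).2
    · filter_upwards [hs.mem_nhds ht] with x hx using (hF' x hx).aestronglyMeasurable
    · exact Eventually.of_forall fun m t ht => h2 t ht m
    · exact Eventually.of_forall fun m t ht => hd' t ht m

/-- The polar kernel, after division by a power of `|x - y|`, as a function of the relative radii
`p`, `q` and of the slope `k`. -/
def modelKernel (n : ℕ) (α : ℝ) (e : ℝ × ℝ × ℝ) : ℝ :=
  ((1 + e.1) * (1 + e.2.1)) ^ (n - 1) *
    (e.2.2 ^ 2 + (1 + e.1) * (1 + e.2.1)) ^ (-(((n : ℝ) + α) / 2))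

theorem measurable_modelKernel (n : ℕ) (α : ℝ) : Measurable (modelKernel n α) := by
  unfold modelKernel
  fun_prop

theorem contDiffOn_modelKernel (n : ℕ) (α : ℝ) :
    ContDiffOn ℝ 2 (modelKernel n α) {e | 0 < 1 + e.1 ∧ 0 < 1 + e.2.1} := by
  unfold modelKernel
  refine ContDiffOn.mul (ContDiff.contDiffOn (by fun_prop)) ?_
  refine ContDiffOn.rpow_const_of_ne (ContDiff.contDiffOn (by fun_prop)) ?_
  rintro e ⟨h1, h2⟩
  positivity

/-- For `|t| < 3/2` and heights at most `1/2`, the scaled heights are at most `3/4 < 1` in absolute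
value, so `t • e` stays in a compact box inside the domain of smoothness. The interval is open and
contains `[-1, 1]`, the range of times needed. -/
theorem exists_bound_modelKernel (n : ℕ) (α : ℝ) :
    ∃ (C : ℝ) (G₁ G₂ : ℝ → ℝ × ℝ × ℝ → ℝ), 0 ≤ C ∧
      ∀ e : ℝ × ℝ × ℝ, |e.1| ≤ 1 / 2 → |e.2.1| ≤ 1 / 2 → |e.2.2| ≤ 1 →
      ∀ t ∈ Ioo (-(3 / 2) : ℝ) (3 / 2),
        HasDerivAt (fun t => modelKernel n α (t • e)) (G₁ t e) t ∧
        HasDerivAt (fun t => G₁ t e) (G₂ t e) t ∧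
        |modelKernel n α (t • e)| ≤ C ∧ |G₁ t e| ≤ C * ‖e‖ ∧ |G₂ t e| ≤ C * ‖e‖ ^ 2 := by
  have hU : IsOpen {e : ℝ × ℝ × ℝ | 0 < 1 + e.1 ∧ 0 < 1 + e.2.1} :=
    IsOpen.and (isOpen_lt (by fun_prop) (by fun_prop)) (isOpen_lt (by fun_prop) (by fun_prop))
  have hK : IsCompact (Icc (-(3 / 4) : ℝ) (3 / 4) ×ˢ Icc (-(3 / 4) : ℝ) (3 / 4) ×ˢ
      Icc (-(3 / 2) : ℝ) (3 / 2)) := isCompact_Icc.prod (isCompact_Icc.prod isCompact_Icc)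
  obtain ⟨C, hC0, hC⟩ := exists_bound_hasDerivAt_comp_smul hU (contDiffOn_modelKernel n α) hK
    (by
      rintro ⟨p, q, k⟩ ⟨hp, hq, -⟩
      exact ⟨by linarith [hp.1], by linarith [hq.1]⟩)
  refine ⟨C, _, _, hC0, fun e h1 h2 h3 t ht => hC e t ?_⟩
  have ht' : |t| ≤ 3 / 2 := abs_le.2 ⟨ht.1.le, ht.2.le⟩
  have aux : ∀ {a c : ℝ}, |a| ≤ c → |t * a| ≤ 3 / 2 * c := fun {a c} ha => by
    rw [abs_mul]
    exact mul_le_mul ht' ha (abs_nonneg _) (by norm_num)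
  refine ⟨abs_le.1 ((aux h1).trans ?_), abs_le.1 ((aux h2).trans ?_), abs_le.1 ((aux h3).trans ?_)⟩
    <;> norm_num

/-! ### The `C¹` norm -/

theorem IsC1.continuous {n : ℕ} {u : Sph n → ℝ} (hu : IsC1 u) : Continuous u := by
  have h := hu.continuousOn.comp_continuous
    (continuous_subtype_val (p := (· ∈ sphere (0 : Space n) 1)))
    (fun x => ne_zero_of_mem_unit_sphere x)
  exact h.congr (radialExt_coe u)

theorem IsC1.bddAbove_norm_fderiv {n : ℕ} {u : Sph n → ℝ} (hu : IsC1 u) :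
    BddAbove (range fun x : Sph n => ‖fderiv ℝ (radialExt u) (x : Space n)‖) := by
  have h0 : ContDiffOn ℝ 0 (fderiv ℝ (radialExt u)) {0}ᶜ :=
    hu.fderiv_of_isOpen isOpen_compl_singleton (by norm_num)
  have h := h0.continuousOn.comp_continuous
    (continuous_subtype_val (p := (· ∈ sphere (0 : Space n) 1)))
    (fun x => ne_zero_of_mem_unit_sphere x)
  exact (isCompact_range h.norm).bddAbove

theorem c1Norm_nonneg {n : ℕ} (u : Sph n → ℝ) : 0 ≤ c1Norm u :=
  add_nonneg (Real.iSup_nonneg fun _ => abs_nonneg _) (Real.iSup_nonneg fun _ => norm_nonneg _)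

theorem IsC1.abs_le_c1Norm {n : ℕ} {u : Sph n → ℝ} (hu : IsC1 u) (x : Sph n) :
    |u x| ≤ c1Norm u :=
  (le_ciSup (isCompact_range hu.continuous.abs).bddAbove x).trans
    (le_add_of_nonneg_right (Real.iSup_nonneg fun _ => norm_nonneg _))

theorem IsC1.norm_fderiv_le_c1Norm {n : ℕ} {u : Sph n → ℝ} (hu : IsC1 u) (x : Sph n) :
    ‖fderiv ℝ (radialExt u) (x : Space n)‖ ≤ c1Norm u :=
  (le_ciSup hu.bddAbove_norm_fderiv x).trans
    (le_add_of_nonneg_left (Real.iSup_nonneg fun _ => abs_nonneg _))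

theorem radialExt_smul {n : ℕ} (u : Sph n → ℝ) {c : ℝ} (hc : 0 < c) (z : Space n) :
    radialExt u (c • z) = radialExt u z := by
  by_cases h : z = 0
  · simp [h]
  · have h' : c • z ≠ 0 := smul_ne_zero hc.ne' h
    simp only [radialExt, h, h', dite_false]
    congr 2
    rw [norm_smul, Real.norm_of_nonneg hc.le, smul_smul]
    congr 1
    field_simp

theorem IsC1.norm_fderiv_le {n : ℕ} {u : Sph n → ℝ} (hu : IsC1 u) {z : Space n} (hz : z ≠ 0) :
    ‖fderiv ℝ (radialExt u) z‖ ≤ c1Norm u / ‖z‖ := by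
  have hz0 : 0 < ‖z‖ := norm_pos_iff.2 hz
  have hc : 0 < ‖z‖⁻¹ := inv_pos.2 hz0
  have h : radialExt u = fun z' => radialExt u (‖z‖⁻¹ • z') :=
    funext fun z' => (radialExt_smul u hc z').symm
  have hx : ‖z‖⁻¹ • z ∈ sphere (0 : Space n) 1 := by simp [norm_smul, hz]
  rw [h, fderiv_comp_smul, norm_smul, Real.norm_of_nonneg hc.le, div_eq_inv_mul]
  exact mul_le_mul_of_nonneg_left (hu.norm_fderiv_le_c1Norm ⟨_, hx⟩) hc.le

/-- If `|x - y| ≤ 1`, the segment from `y` to `x` stays at distance at least `1/2` from the origin,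
where the gradient of the extension is at most twice the norm. If `|x - y| > 1`, the bound on `|u|`
suffices. -/
theorem IsC1.abs_sub_le {n : ℕ} {u : Sph n → ℝ} (hu : IsC1 u) (x y : Sph n) :
    |u x - u y| ≤ 2 * c1Norm u * ‖(x : Space n) - y‖ := by
  have hx : ‖(x : Space n)‖ = 1 := norm_eq_of_mem_sphere x
  have hy : ‖(y : Space n)‖ = 1 := norm_eq_of_mem_sphere y
  rcases le_or_gt ‖(x : Space n) - y‖ 1 with h | h
  · have hseg : ∀ z ∈ segment ℝ (y : Space n) x, 1 / 2 ≤ ‖z‖ := by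
      intro z hz
      have h1 := dist_add_dist_of_mem_segment hz
      rw [dist_eq_norm, dist_eq_norm, dist_eq_norm, norm_sub_rev (y : Space n) x] at h1
      have h2 := norm_sub_norm_le (y : Space n) z
      have h3 := norm_sub_norm_le (x : Space n) z
      rw [norm_sub_rev z] at h1
      linarith
    have hne : ∀ z ∈ segment ℝ (y : Space n) x, z ≠ 0 := fun z hz h0 => by
      have := hseg z hz
      rw [h0, norm_zero] at this
      norm_num at this
    have key := (convex_segment (y : Space n) (x : Space n)).norm_image_sub_le_of_norm_fderiv_le
      (𝕜 := ℝ) (f := radialExt u) (C := 2 * c1Norm u)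
      (fun z hz => (hu.contDiffAt (isOpen_compl_singleton.mem_nhds (hne z hz))).differentiableAt
        (by norm_num))
      (fun z hz => (hu.norm_fderiv_le (hne z hz)).trans ?_)
      (left_mem_segment ℝ _ _) (right_mem_segment ℝ _ _)
    · rwa [radialExt_coe, radialExt_coe, Real.norm_eq_abs] at key
    · have h1 := hseg z hz
      rw [div_le_iff₀ (by linarith)]
      nlinarith [c1Norm_nonneg u]
  · have h1 := hu.abs_le_c1Norm x
    have h2 := hu.abs_le_c1Norm y
    have h3 := abs_sub (u x) (u y)
    nlinarith [c1Norm_nonneg u]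

/-! ### Uniform estimates for powers of `1 + t v` -/

theorem exists_rpow_one_add_mul_le (c : ℝ) : ∃ C : ℝ, 0 ≤ C ∧ ∀ v : ℝ, |v| ≤ 1 / 2 →
    ∀ t ∈ Ioo (-(3 / 2) : ℝ) (3 / 2), 0 < 1 + t * v ∧ (1 + t * v) ^ c ≤ C := by
  have hc : ContinuousOn (fun x : ℝ => x ^ c) (Icc (1 / 4 : ℝ) (7 / 4)) := fun x hx =>
    (Real.continuousAt_rpow_const x c (Or.inl (by linarith [hx.1]))).continuousWithinAt
  obtain ⟨C, hC⟩ := isCompact_Icc.exists_bound_of_continuousOn hc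
  refine ⟨max 0 C, le_max_left _ _, fun v hv t ht => ?_⟩
  have h : |t * v| ≤ 3 / 2 * (1 / 2) := by
    rw [abs_mul]
    exact mul_le_mul (abs_le.2 ⟨ht.1.le, ht.2.le⟩) hv (abs_nonneg _) (by norm_num)
  have h' := abs_le.1 h
  exact ⟨by linarith [h'.1], (le_abs_self _).trans ((hC (1 + t * v) ⟨by linarith [h'.1],
    by linarith [h'.2]⟩).trans (le_max_right _ _))⟩

theorem one_add_mul_pos {v t : ℝ} (hv : |v| ≤ 1 / 2) (ht : t ∈ Ioo (-(3 / 2) : ℝ) (3 / 2)) :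
    0 < 1 + t * v := by
  obtain ⟨C, -, hC⟩ := exists_rpow_one_add_mul_le 0
  exact (hC v hv t ht).1

theorem exists_abs_rpow_sub_one_le (c : ℝ) : ∃ C : ℝ, 0 ≤ C ∧ ∀ v : ℝ, |v| ≤ 1 / 2 →
    |(1 + v) ^ c - 1| ≤ C * |v| := by
  obtain ⟨C, hC0, hC⟩ := exists_rpow_one_add_mul_le (c - 1)
  refine ⟨|c| * C, by positivity, fun v hv => ?_⟩
  have h := norm_image_sub_le_of_norm_deriv_le_segment_01' (f := fun t : ℝ => (1 + t * v) ^ c)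
    (f' := fun t => v * c * (1 + t * v) ^ (c - 1)) (C := |c| * C * |v|)
    (fun t ht => ?_) (fun t ht => ?_)
  · simpa using h
  · obtain ⟨h0, -⟩ := hC v hv t ⟨by linarith [ht.1], by linarith [ht.2]⟩
    have : HasDerivAt (fun t : ℝ => 1 + t * v) v t := by
      simpa using ((hasDerivAt_id t).mul_const v).const_add 1
    exact (this.rpow_const (Or.inl h0.ne')).hasDerivWithinAt
  · obtain ⟨h0, h1⟩ := hC v hv t ⟨by linarith [ht.1], by linarith [ht.2]⟩
    rw [norm_mul, norm_mul, Real.norm_eq_abs, Real.norm_eq_abs,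
      Real.norm_of_nonneg (by positivity)]
    nlinarith [mul_nonneg (abs_nonneg v) (abs_nonneg c)]

/-! ### First and second variation along a line -/

/-- When base point and both directions are proportional to `u`, every set involved is some `E_{t
u}`, and the variations are ordinary derivatives of `t ↦ P_α(t u)`. -/
theorem hasSecondVariation_of_hasDerivAt {n : ℕ} {α : ℝ} {u : Sph n → ℝ} {p₁ p₂ : ℝ → ℝ} {R : ℝ}
    (hfin : ∀ t ∈ Ioo (-R) R, perimeter α (nearlySpherical (t • u)) ≠ ∞)
    (h₁ : ∀ t ∈ Ioo (-R) R, HasDerivAt (fun t : ℝ => perimeterOf α (t • u)) (p₁ t) t)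
    (h₂ : ∀ t ∈ Ioo (-R) R, HasDerivAt p₁ (p₂ t) t) {l : ℝ} (hl : l ∈ Ioo (-R) R) :
    HasSecondVariation α (l • u) u u ∧ secondVariation α (l • u) u u = p₂ l := by
  have hadd : ∀ a s : ℝ, a • u + s • u = (a + s) • u := fun a s => (add_smul a s u).symm
  have hshift : ∀ {f : ℝ → ℝ} {f' a : ℝ}, HasDerivAt f f' a →
      HasDerivAt (fun s => f (a + s)) f' 0 := fun {f f' a} h => by
    have := HasDerivAt.comp_const_add a 0 (f := f) (f' := f') (by simpa using h)
    exact this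
  have hnear : ∀ a ∈ Ioo (-R) R, ∀ᶠ s : ℝ in 𝓝 0, a + s ∈ Ioo (-R) R := fun a ha =>
    (show ContinuousAt (fun s : ℝ => a + s) 0 by fun_prop).eventually_mem
      (isOpen_Ioo.mem_nhds (by simpa using ha))
  have first : ∀ a ∈ Ioo (-R) R, HasFirstVariation α (a • u) u ∧
      firstVariation α (a • u) u = p₁ a := by
    intro a ha
    have hd := hshift (h₁ a ha)
    simp only [HasFirstVariation, firstVariation, hadd]
    exact ⟨⟨(hnear a ha).mono fun s hs => hfin _ hs, hd.differentiableAt⟩, hd.deriv⟩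
  have hev : (fun t : ℝ => firstVariation α ((l + t) • u) u) =ᶠ[𝓝 0] fun t => p₁ (l + t) :=
    (hnear l hl).mono fun t ht => (first _ ht).2
  have hd := (hshift (h₂ l hl)).congr_of_eventuallyEq hev
  simp only [HasSecondVariation, secondVariation, hadd]
  exact ⟨⟨(hnear l hl).mono fun t ht => (first _ ht).1, hd.differentiableAt⟩, hd.deriv⟩

open unitInterval in
/-- The parameter space of a pair of points of `∂B` and a pair of heights. -/
abbrev Chord (n : ℕ) : Type := (Sph n × Sph n) × (I × I)

abbrev chordMeasure (n : ℕ) : Measure (Chord n) :=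
  ((surfaceMeasure n).prod (surfaceMeasure n)).prod volume

/-- The integrand of the squared Gagliardo seminorm of order `(1 + α) / 2`. -/
def gagliardoDensity {n : ℕ} (α : ℝ) (u : Sph n → ℝ) (p : Sph n × Sph n) : ℝ :=
  (u p.1 - u p.2) ^ 2 / ‖(p.1 : Space n) - (p.2 : Space n)‖ ^ ((n : ℝ) + α)

/-- Two heights between `u y` and `u x`, and the slope of the chord between them. -/
def chordVector {n : ℕ} (u : Sph n → ℝ) (m : Chord n) : ℝ × ℝ × ℝ :=
  (u m.1.2 + m.2.1 * (u m.1.1 - u m.1.2), u m.1.2 + m.2.2 * (u m.1.1 - u m.1.2),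
    ((m.2.1 : ℝ) - m.2.2) * ((u m.1.1 - u m.1.2) / ‖(m.1.1 : Space n) - m.1.2‖))

theorem measurable_gagliardoDensity {n : ℕ} (α : ℝ) {u : Sph n → ℝ} (hu : Measurable u) :
    Measurable (gagliardoDensity α u) := by
  unfold gagliardoDensity
  fun_prop

theorem measurable_chordVector {n : ℕ} {u : Sph n → ℝ} (hu : Measurable u) :
    Measurable (chordVector u) := by
  unfold chordVector
  fun_prop

theorem gagliardoDensity_nonneg {n : ℕ} (α : ℝ) (u : Sph n → ℝ) (p : Sph n × Sph n) :
    0 ≤ gagliardoDensity α u p := by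
  unfold gagliardoDensity
  positivity

theorem gagliardoSq_eq {n : ℕ} (α : ℝ) (u : Sph n → ℝ) :
    gagliardoSq ((1 + α) / 2) u =
      ∫ p, gagliardoDensity α u p ∂((surfaceMeasure n).prod (surfaceMeasure n)) := by
  unfold gagliardoSq gagliardoDensity
  rw [show (n : ℝ) - 1 + 2 * ((1 + α) / 2) = n + α by ring]

theorem abs_chordVector_le {n : ℕ} {u : Sph n → ℝ} {ε : ℝ} (hb : ∀ x, |u x| ≤ ε)
    (hl : ∀ x y, |u x - u y| ≤ 2 * ε * ‖(x : Space n) - y‖) (m : Chord n) :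
    |(chordVector u m).1| ≤ ε ∧ |(chordVector u m).2.1| ≤ ε ∧ |(chordVector u m).2.2| ≤ 2 * ε := by
  obtain ⟨⟨x, y⟩, ⟨ξ, hξ0, hξ1⟩, ⟨η, hη0, hη1⟩⟩ := m
  have hε : 0 ≤ ε := (abs_nonneg _).trans (hb x)
  have conv : ∀ s : ℝ, 0 ≤ s → s ≤ 1 → |u y + s * (u x - u y)| ≤ ε := by
    intro s h0 h1
    have hx := abs_le.1 (hb x)
    have hy := abs_le.1 (hb y)
    rw [abs_le]
    constructor <;> nlinarith
  refine ⟨conv ξ hξ0 hξ1, conv η hη0 hη1, ?_⟩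
  simp only [chordVector, abs_mul, abs_div, abs_norm]
  have h1 : |ξ - η| ≤ 1 := abs_le.2 ⟨by linarith, by linarith⟩
  have h2 : |u x - u y| / ‖(x : Space n) - y‖ ≤ 2 * ε :=
    div_le_of_le_mul₀ (norm_nonneg _) (by positivity) (hl x y)
  calc _ ≤ 1 * (2 * ε) := mul_le_mul h1 h2 (by positivity) zero_le_one
    _ = 2 * ε := one_mul _

theorem norm_chordVector_le {n : ℕ} {u : Sph n → ℝ} {ε : ℝ} (hb : ∀ x, |u x| ≤ ε)
    (hl : ∀ x y, |u x - u y| ≤ 2 * ε * ‖(x : Space n) - y‖) (m : Chord n) :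
    ‖chordVector u m‖ ≤ 2 * ε := by
  obtain ⟨h1, h2, h3⟩ := abs_chordVector_le hb hl m
  have hε : 0 ≤ ε := (abs_nonneg _).trans h1
  exact max_le (h1.trans (by linarith)) (max_le (h2.trans (by linarith)) h3)

/-- The Lipschitz bound cancels two powers of `|x - y|`, leaving the exponent `n - 2 + α`, below the
dimension `n - 1` of the sphere because `α < 1`. -/
theorem integrable_gagliardoDensity {n : ℕ} (hn : 2 ≤ n) {α : ℝ} (hα0 : 0 < α) (hα1 : α < 1)
    {u : Sph n → ℝ} (hu : Measurable u) {L : ℝ}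
    (hl : ∀ x y, |u x - u y| ≤ L * ‖(x : Space n) - y‖) :
    Integrable (gagliardoDensity α u) ((surfaceMeasure n).prod (surfaceMeasure n)) := by
  have hn' : (2 : ℝ) ≤ n := by exact_mod_cast hn
  obtain ⟨C, hC, hCb⟩ := exists_lintegral_sphere_rpow_le (n := n) (by omega)
    (s := (n : ℝ) - 2 + α) (by linarith) (by linarith)
  have hR : Integrable (fun p : Sph n × Sph n =>
      1 / ‖(p.1 : Space n) - p.2‖ ^ ((n : ℝ) - 2 + α))
      ((surfaceMeasure n).prod (surfaceMeasure n)) := by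
    refine ⟨Measurable.aestronglyMeasurable (by fun_prop), ?_⟩
    rw [hasFiniteIntegral_iff_ofReal (Eventually.of_forall fun p => by positivity),
      lintegral_prod _ (by fun_prop)]
    refine (lintegral_mono hCb).trans_lt ?_
    rw [lintegral_const]
    exact ENNReal.mul_lt_top hC (measure_lt_top _ _)
  refine (hR.const_mul (L ^ 2)).mono' (measurable_gagliardoDensity α hu).aestronglyMeasurable
    (Eventually.of_forall fun p => ?_)
  rw [Real.norm_of_nonneg (gagliardoDensity_nonneg α u p), gagliardoDensity]
  rcases (norm_nonneg ((p.1 : Space n) - p.2)).eq_or_lt with h0 | h0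
  · have hz : u p.1 - u p.2 = 0 := by
      have := hl p.1 p.2
      rw [← h0, mul_zero] at this
      exact abs_eq_zero.1 (le_antisymm this (abs_nonneg _))
    rw [hz]
    simp only [ne_eq, OfNat.ofNat_ne_zero, not_false_eq_true, zero_pow, zero_div]
    positivity
  · have e : ‖(p.1 : Space n) - p.2‖ ^ ((n : ℝ) + α) =
        ‖(p.1 : Space n) - p.2‖ ^ 2 * ‖(p.1 : Space n) - p.2‖ ^ ((n : ℝ) - 2 + α) := by
      rw [← Real.rpow_natCast, ← Real.rpow_add h0]
      congr 1
      push_cast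
      ring
    have h2 : (u p.1 - u p.2) ^ 2 ≤ L ^ 2 * ‖(p.1 : Space n) - p.2‖ ^ 2 := by
      rw [← sq_abs, ← mul_pow]
      exact pow_le_pow_left₀ (abs_nonneg _) (hl _ _) 2
    rw [e, div_le_iff₀ (by positivity)]
    refine h2.trans (le_of_eq ?_)
    field_simp

/-- Since `r - ρ = |x - y| k` with `k` the scaled slope, `|r x - ρ y|² = |x - y|² (k² + r ρ)`: the
singularity factors out and the rest is smooth. -/
theorem polarKernel_eq_modelKernel {n : ℕ} (α : ℝ) (u : Sph n → ℝ) {x y : Sph n} (hxy : x ≠ y)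
    {t ξ η : ℝ} (h1 : 0 < 1 + t * (u y + ξ * (u x - u y)))
    (h2 : 0 < 1 + t * (u y + η * (u x - u y))) :
    polarKernel α x y (1 + t * (u y + ξ * (u x - u y))) (1 + t * (u y + η * (u x - u y))) =
      modelKernel n α (t • (u y + ξ * (u x - u y), u y + η * (u x - u y),
        (ξ - η) * ((u x - u y) / ‖(x : Space n) - y‖))) /
        ‖(x : Space n) - y‖ ^ ((n : ℝ) + α) := by
  have hθ : 0 < ‖(x : Space n) - y‖ := by
    rw [norm_pos_iff, sub_ne_zero]
    exact fun h => hxy (Subtype.ext h)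
  set θ := ‖(x : Space n) - y‖ with hθdef
  set r := 1 + t * (u y + ξ * (u x - u y)) with hr
  set ρ := 1 + t * (u y + η * (u x - u y)) with hρ
  set k := t * ((ξ - η) * ((u x - u y) / θ)) with hk
  have hsq : ‖r • (x : Space n) - ρ • (y : Space n)‖ ^ 2 = θ ^ 2 * (k ^ 2 + r * ρ) := by
    rw [norm_smul_sub_smul_sq, ← hθdef]
    have : r - ρ = θ * k := by
      rw [hr, hρ, hk]
      field_simp
      ring
    rw [this]
    ring
  have hpow : ∀ a : ℝ, 0 ≤ a → a ^ ((n : ℝ) + α) = (a ^ 2) ^ (((n : ℝ) + α) / 2) := by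
    intro a ha
    rw [← Real.rpow_natCast, ← Real.rpow_mul ha]
    congr 1
    push_cast
    ring
  have hpos : 0 < k ^ 2 + r * ρ := by positivity
  simp only [polarKernel, modelKernel, Prod.smul_mk, smul_eq_mul, ← hr, ← hρ, ← hk]
  rw [hpow _ (norm_nonneg _), hsq, Real.mul_rpow (by positivity) hpos.le, ← hpow θ hθ.le,
    Real.rpow_neg hpos.le]
  field_simp
  rw [mul_pow]

theorem lintegral_Ioc_eq_unitInterval (f : ℝ → ℝ≥0∞) :
    ∫⁻ ξ in Ioc (0 : ℝ) 1, f ξ = ∫⁻ ξ : unitInterval, f ξ := by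
  rw [restrict_Ioc_eq_restrict_Icc]
  exact (lintegral_subtype_comap measurableSet_Icc f).symm

theorem two_mul_perimeter_smul_eq {n : ℕ} (hn : n ≠ 0) {α ε : ℝ} {u : Sph n → ℝ}
    (hu : Continuous u) (hb : ∀ x, |u x| ≤ ε) (hε : ε ≤ 1 / 2) {t : ℝ}
    (ht : t ∈ Ioo (-(3 / 2) : ℝ) (3 / 2)) :
    2 * perimeter α (nearlySpherical (t • u)) =
      2 * ∫⁻ x, ENNReal.ofReal ((1 + t * u x) ^ ((n : ℝ) - α)) * spherePotential α x
        ∂(surfaceMeasure n) +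
      ∫⁻ m, ENNReal.ofReal (t ^ 2 * modelKernel n α (t • chordVector u m) *
        gagliardoDensity α u m.1) ∂(chordMeasure n) := by
  have hpos : ∀ v : ℝ, |v| ≤ ε → 0 < 1 + t * v := fun v hv =>
    one_add_mul_pos (hv.trans hε) ht
  rw [two_mul_perimeter_eq hn α (w := t • u) (hu.const_smul t) fun x => by
    have := hpos _ (hb x)
    simp only [Pi.smul_apply, smul_eq_mul]
    linarith]
  simp only [Pi.smul_apply, smul_eq_mul]
  congr 1
  have hm : Measurable fun m : Chord n => ENNReal.ofReal (t ^ 2 *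
      modelKernel n α (t • chordVector u m) * gagliardoDensity α u m.1) := by
    have := measurable_modelKernel n α
    have := measurable_chordVector hu.measurable
    have := measurable_gagliardoDensity α hu.measurable
    fun_prop
  rw [lintegral_prod _ hm.aemeasurable, lintegral_prod]
  swap
  · exact (Measurable.lintegral_prod_right' hm).aemeasurable
  congr! 2 with x
  congr! 2 with y
  rw [Measure.volume_eq_prod, lintegral_prod]
  swap
  · exact (hm.comp measurable_prodMk_left).aemeasurable
  simp only [lintegral_Ioc_eq_unitInterval]
  congr! 2 with ξ
  congr! 2 with η
  congr 1
  -- On the diagonal the increment of `u` vanishes, hence both integrands do.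
  rcases eq_or_ne x y with rfl | hxy
  · simp [gagliardoDensity]
  have conv : ∀ s : unitInterval, |u y + s * (u x - u y)| ≤ ε := by
    rintro ⟨s, h0, h1⟩
    have hx := abs_le.1 (hb x)
    have hy := abs_le.1 (hb y)
    rw [abs_le]
    constructor <;> dsimp only <;> nlinarith
  have harg : ∀ s : unitInterval, 1 + (t * u y + s * (t * u x - t * u y)) =
      1 + t * (u y + s * (u x - u y)) := fun s => by ring
  rw [harg, harg, polarKernel_eq_modelKernel α u hxy (hpos _ (conv ξ)) (hpos _ (conv η))]
  simp only [gagliardoDensity, chordVector]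
  ring

/-! ### The second derivative of the perimeter -/

theorem measurable_spherePotential {n : ℕ} (α : ℝ) : Measurable (spherePotential (n := n) α) := by
  have hM : Measurable₄ (n := n) (cutKernel α fun _ _ r ρ => r ≤ 1 ∧ 1 < ρ) :=
    measurable₄_cutKernel (by measurability)
  exact Measurable.lintegral_prod_right' (hM.lintegral₂ (volume.restrict (Ioi 0)))

theorem exists_toReal_spherePotential_le {n : ℕ} (hn : n ≠ 0) {α : ℝ} (hα0 : 0 < α) (hα1 : α < 1) :
    ∃ C : ℝ, 0 ≤ C ∧ ∀ x : Sph n, spherePotential α x = ENNReal.ofReal (spherePotential α x).toReal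
      ∧ (spherePotential α x).toReal ≤ C := by
  obtain ⟨C, hC, h⟩ := exists_spherePotential_le hn hα0 hα1
  exact ⟨C.toReal, ENNReal.toReal_nonneg, fun x =>
    ⟨(ENNReal.ofReal_toReal ((h x).trans_lt hC).ne).symm, ENNReal.toReal_mono hC.ne (h x)⟩⟩

theorem perimeterOf_smul_eq {n : ℕ} (hn : n ≠ 0) {α ε : ℝ} (hα0 : 0 < α) (hα1 : α < 1)
    {u : Sph n → ℝ} (hu : Continuous u) (hb : ∀ x, |u x| ≤ ε) (hε : ε ≤ 1 / 2) {t : ℝ}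
    (ht : t ∈ Ioo (-(3 / 2) : ℝ) (3 / 2))
    (hi₁ : Integrable (fun x => (1 + t * u x) ^ ((n : ℝ) - α) * (spherePotential α x).toReal)
      (surfaceMeasure n))
    (hi₂ : Integrable (fun m => t ^ 2 * modelKernel n α (t • chordVector u m) *
      gagliardoDensity α u m.1) (chordMeasure n))
    (hpos : ∀ m, 0 ≤ modelKernel n α (t • chordVector u m)) :
    perimeter α (nearlySpherical (t • u)) ≠ ∞ ∧ perimeterOf α (t • u) =
      (∫ x, (1 + t * u x) ^ ((n : ℝ) - α) * (spherePotential α x).toReal ∂(surfaceMeasure n)) +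
      1 / 2 * ∫ m, t ^ 2 * modelKernel n α (t • chordVector u m) * gagliardoDensity α u m.1
        ∂(chordMeasure n) := by
  obtain ⟨CΦ, -, hΦ⟩ := exists_toReal_spherePotential_le hn hα0 hα1
  have h1pos : ∀ x, 0 ≤ 1 + t * u x := fun x =>
    (one_add_mul_pos ((hb x).trans hε) ht).le
  have h := two_mul_perimeter_smul_eq (α := α) hn hu hb hε ht
  have e1 : ∫⁻ x, ENNReal.ofReal ((1 + t * u x) ^ ((n : ℝ) - α)) * spherePotential α x
      ∂(surfaceMeasure n) = ENNReal.ofReal (∫ x, (1 + t * u x) ^ ((n : ℝ) - α) *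
        (spherePotential α x).toReal ∂(surfaceMeasure n)) := by
    rw [ofReal_integral_eq_lintegral_ofReal hi₁ (Eventually.of_forall fun x =>
      mul_nonneg (Real.rpow_nonneg (h1pos x) _) ENNReal.toReal_nonneg)]
    congr! 2 with x
    rw [ENNReal.ofReal_mul (Real.rpow_nonneg (h1pos x) _), ← (hΦ x).1]
  rw [e1, ← ofReal_integral_eq_lintegral_ofReal hi₂ (Eventually.of_forall fun m =>
    mul_nonneg (mul_nonneg (sq_nonneg t) (hpos m)) (gagliardoDensity_nonneg α u m.1))] at h
  set A := ∫ x, (1 + t * u x) ^ ((n : ℝ) - α) * (spherePotential α x).toReal ∂(surfaceMeasure n)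
  set B := ∫ m, t ^ 2 * modelKernel n α (t • chordVector u m) * gagliardoDensity α u m.1
        ∂(chordMeasure n)
  have hA : 0 ≤ A := integral_nonneg fun x =>
    mul_nonneg (Real.rpow_nonneg (h1pos x) _) ENNReal.toReal_nonneg
  have hB : 0 ≤ B := integral_nonneg fun m =>
    mul_nonneg (mul_nonneg (sq_nonneg t) (hpos m)) (gagliardoDensity_nonneg α u m.1)
  have hfin : perimeter α (nearlySpherical (t • u)) ≠ ∞ := by
    intro htop
    rw [htop, ENNReal.mul_top (by norm_num)] at h
    exact (ENNReal.add_lt_top.2 ⟨ENNReal.mul_lt_top (by norm_num) ENNReal.ofReal_lt_top,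
      ENNReal.ofReal_lt_top⟩).ne h.symm
  refine ⟨hfin, ?_⟩
  have h' := congrArg ENNReal.toReal h
  rw [ENNReal.toReal_add (by finiteness) (by finiteness), ENNReal.toReal_mul, ENNReal.toReal_mul,
    ENNReal.toReal_ofReal hA, ENNReal.toReal_ofReal hB, ENNReal.toReal_ofNat] at h'
  unfold perimeterOf
  linarith

theorem modelKernel_nonneg {n : ℕ} {α : ℝ} {e : ℝ × ℝ × ℝ} (h1 : |e.1| ≤ 1 / 2)
    (h2 : |e.2.1| ≤ 1 / 2) {t : ℝ} (ht : t ∈ Ioo (-(3 / 2) : ℝ) (3 / 2)) :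
    0 ≤ modelKernel n α (t • e) := by
  have p1 := one_add_mul_pos h1 ht
  have p2 := one_add_mul_pos h2 ht
  simp only [modelKernel, Prod.smul_fst, Prod.smul_snd, smul_eq_mul]
  positivity

theorem hasDerivAt_one_add_mul_rpow {v t c : ℝ} (h : 0 < 1 + t * v) :
    HasDerivAt (fun t : ℝ => (1 + t * v) ^ c) (v * c * (1 + t * v) ^ (c - 1)) t := by
  have : HasDerivAt (fun t : ℝ => 1 + t * v) v t := by
    simpa using ((hasDerivAt_id t).mul_const v).const_add 1
  exact this.rpow_const (Or.inl h.ne')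

theorem abs_integral_le_const_mul {X : Type*} [MeasurableSpace X] {μ : Measure X} {f g : X → ℝ}
    {c : ℝ} (hg : Integrable g μ) (h : ∀ x, |f x| ≤ c * g x) :
    |∫ x, f x ∂μ| ≤ c * ∫ x, g x ∂μ := by
  rw [← integral_const_mul]
  exact norm_integral_le_of_norm_le (f := f) (hg.const_mul c)
    (Eventually.of_forall fun x => (Real.norm_eq_abs _).trans_le (h x))

/-- Second derivative of `t ↦ ∫ (1 + t u)^γ φ` for a bounded weight `φ`. -/
theorem exists_hasDerivAt_integral_rpow {X : Type*} [MeasurableSpace X] (μ : Measure X)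
    [IsFiniteMeasure μ] (γ : ℝ) {φ : X → ℝ} {B : ℝ} (hφm : Measurable φ) (hφ0 : ∀ x, 0 ≤ φ x)
    (hφB : ∀ x, φ x ≤ B) :
    ∃ C : ℝ, 0 ≤ C ∧ ∀ (u : X → ℝ) (ε : ℝ), Measurable u → ε ≤ 1 / 2 → (∀ x, |u x| ≤ ε) →
      ∃ p₁ p₂ : ℝ → ℝ, (∀ t ∈ Ioo (-(3 / 2) : ℝ) (3 / 2),
        Integrable (fun x => (1 + t * u x) ^ γ * φ x) μ ∧
        HasDerivAt (fun t : ℝ => ∫ x, (1 + t * u x) ^ γ * φ x ∂μ) (p₁ t) t ∧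
        HasDerivAt p₁ (p₂ t) t ∧ |p₂ t| ≤ C * ∫ x, u x ^ 2 ∂μ) ∧
        |p₂ 1 - p₂ 0| ≤ C * ε * ∫ x, u x ^ 2 ∂μ := by
  -- A point of `X` is needed to deduce `0 ≤ B` from `0 ≤ φ ≤ B`.
  rcases isEmpty_or_nonempty X with hX | ⟨⟨x₀⟩⟩
  · refine ⟨0, le_rfl, fun u ε _ _ _ => ⟨0, 0, fun t _ => ?_, by simp⟩⟩
    simp only [Measure.eq_zero_of_isEmpty, integral_zero_measure, integrable_zero_measure,
      true_and]
    exact ⟨hasDerivAt_const t 0, hasDerivAt_const t 0, by simp⟩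
  have hB0 : 0 ≤ B := (hφ0 x₀).trans (hφB x₀)
  obtain ⟨A0, hA0, hA0b⟩ := exists_rpow_one_add_mul_le γ
  obtain ⟨A1, hA1, hA1b⟩ := exists_rpow_one_add_mul_le (γ - 1)
  obtain ⟨A2, hA2, hA2b⟩ := exists_rpow_one_add_mul_le (γ - 1 - 1)
  obtain ⟨A3, hA3, hA3b⟩ := exists_abs_rpow_sub_one_le (γ - 1 - 1)
  have hΓ0 : 0 ≤ |γ * (γ - 1)| := abs_nonneg _
  refine ⟨|γ * (γ - 1)| * B * (A2 + A3), by positivity, fun u ε hu hε hb => ?_⟩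
  have hub : ∀ x, |u x| ≤ 1 / 2 := fun x => (hb x).trans hε
  have husq : ∀ x, u x ^ 2 ≤ 1 := fun x => by
    rw [← sq_abs]; exact pow_le_one₀ (abs_nonneg _) (by linarith [hub x])
  have hui : Integrable (fun x => u x ^ 2) μ :=
    (integrable_const (1 : ℝ)).mono' (hu.pow_const 2).aestronglyMeasurable
      (Eventually.of_forall fun x => by
        rw [Real.norm_of_nonneg (sq_nonneg _)]; exact husq x)
  have h2b : ∀ t ∈ Ioo (-(3 / 2) : ℝ) (3 / 2), ∀ x,
      |γ * (γ - 1) * (1 + t * u x) ^ (γ - 1 - 1) * u x ^ 2 * φ x| ≤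
        |γ * (γ - 1)| * B * A2 * u x ^ 2 := fun t ht x => by
    obtain ⟨h0, h1⟩ := hA2b _ (hub x) t ht
    rw [abs_mul, abs_mul, abs_mul, abs_of_nonneg (hφ0 x), abs_of_nonneg (Real.rpow_nonneg h0.le _),
      abs_of_nonneg (sq_nonneg (u x))]
    calc _ ≤ |γ * (γ - 1)| * A2 * u x ^ 2 * B := by
          gcongr
          exacts [hφ0 x, hφB x]
      _ = _ := by ring
  have key := fun t (ht : t ∈ Ioo (-(3 / 2) : ℝ) (3 / 2)) => hasDerivAt_integral_twice
    (μ := μ) (F := fun t x => (1 + t * u x) ^ γ * φ x)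
    (F' := fun t x => u x * γ * (1 + t * u x) ^ (γ - 1) * φ x)
    (F'' := fun t x => γ * (γ - 1) * (1 + t * u x) ^ (γ - 1 - 1) * u x ^ 2 * φ x)
    (b := fun _ => A0 * B + |γ| * A1 * B + |γ * (γ - 1)| * B * A2) isOpen_Ioo
    (integrable_const _) (fun t _ => by fun_prop)
    (fun t ht x => (hasDerivAt_one_add_mul_rpow (one_add_mul_pos (hub x) ht)).mul_const (φ x))
    (fun t ht x => (((hasDerivAt_one_add_mul_rpow (one_add_mul_pos (hub x) ht)).const_mul
      (u x * γ)).mul_const (φ x)).congr_deriv (by ring))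
    (fun t ht x => by
      obtain ⟨h0, h1⟩ := hA0b _ (hub x) t ht
      rw [abs_of_nonneg (mul_nonneg (Real.rpow_nonneg h0.le _) (hφ0 x))]
      have h2 := mul_le_mul h1 (hφB x) (hφ0 x) hA0
      have : 0 ≤ |γ| * A1 * B + |γ * (γ - 1)| * B * A2 := by positivity
      linarith)
    (fun t ht x => by
      obtain ⟨h0, h1⟩ := hA1b _ (hub x) t ht
      rw [abs_mul, abs_of_nonneg (hφ0 x), abs_mul, abs_mul,
        abs_of_nonneg (Real.rpow_nonneg h0.le _)]
      have h2 : |u x| * |γ| ≤ |γ| := mul_le_of_le_one_left (abs_nonneg _) (by linarith [hub x])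
      have h3 := mul_le_mul (mul_le_mul h2 h1 (Real.rpow_nonneg h0.le _) (abs_nonneg γ)) (hφB x)
        (hφ0 x) (by positivity)
      have : 0 ≤ A0 * B + |γ * (γ - 1)| * B * A2 := by positivity
      linarith)
    (fun t ht x => by
      have h1 := h2b t ht x
      have h2 := mul_le_mul_of_nonneg_left (husq x)
        (show 0 ≤ |γ * (γ - 1)| * B * A2 by positivity)
      have : 0 ≤ A0 * B + |γ| * A1 * B := by positivity
      linarith) ht
  refine ⟨_, _, fun t ht => ⟨(key t ht).1, (key t ht).2.2.1, (key t ht).2.2.2, ?_⟩, ?_⟩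
  · refine abs_integral_le_const_mul hui fun x => (h2b t ht x).trans ?_
    have : 0 ≤ |γ * (γ - 1)| * B * A3 * u x ^ 2 := by positivity
    linarith
  · rw [← integral_sub (key 1 (by norm_num)).2.1 (key 0 (by norm_num)).2.1]
    refine abs_integral_le_const_mul hui fun x => ?_
    have e : γ * (γ - 1) * (1 + 1 * u x) ^ (γ - 1 - 1) * u x ^ 2 * φ x -
        γ * (γ - 1) * (1 + 0 * u x) ^ (γ - 1 - 1) * u x ^ 2 * φ x =
        γ * (γ - 1) * ((1 + u x) ^ (γ - 1 - 1) - 1) * u x ^ 2 * φ x := by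
      rw [zero_mul, add_zero, Real.one_rpow, one_mul]
      ring
    have hε0 : 0 ≤ ε := (abs_nonneg _).trans (hb x)
    rw [e, abs_mul, abs_mul, abs_mul, abs_of_nonneg (hφ0 x),
      abs_of_nonneg (sq_nonneg (u x))]
    calc _ ≤ |γ * (γ - 1)| * (A3 * ε) * u x ^ 2 * B := by
          gcongr
          · exact hφ0 x
          · exact (hA3b _ (hub x)).trans (mul_le_mul_of_nonneg_left (hb x) hA3)
          · exact hφB x
      _ ≤ _ := by
          have : 0 ≤ |γ * (γ - 1)| * B * A2 * ε * u x ^ 2 := by positivity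
          linarith

/-- Second derivative of the interaction of pairs of points of the sphere. -/
theorem exists_hasDerivAt_integral_chord {n : ℕ} (hn : 2 ≤ n) {α : ℝ} (hα0 : 0 < α)
    (hα1 : α < 1) :
    ∃ C : ℝ, 0 ≤ C ∧ ∀ (u : Sph n → ℝ) (ε : ℝ), Continuous u → ε ≤ 1 / 2 → (∀ x, |u x| ≤ ε) →
      (∀ x y, |u x - u y| ≤ 2 * ε * ‖(x : Space n) - y‖) →
      ∃ p₁ p₂ : ℝ → ℝ, (∀ t ∈ Ioo (-(3 / 2) : ℝ) (3 / 2),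
        Integrable (fun m => t ^ 2 * modelKernel n α (t • chordVector u m) *
          gagliardoDensity α u m.1) (chordMeasure n) ∧
        HasDerivAt (fun t : ℝ => ∫ m, t ^ 2 * modelKernel n α (t • chordVector u m) *
          gagliardoDensity α u m.1 ∂(chordMeasure n)) (p₁ t) t ∧
        HasDerivAt p₁ (p₂ t) t ∧ |p₂ t| ≤ C * gagliardoSq ((1 + α) / 2) u) ∧
        |p₂ 1 - p₂ 0| ≤ C * ε * gagliardoSq ((1 + α) / 2) u := by
  obtain ⟨B, G₁, G₂, hB, hBb⟩ := exists_bound_modelKernel n α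
  -- The difference of second derivatives at `1` and `0` costs `2 · 2 + 4 · 2 + 2 = 14` times `B ε`.
  -- The same constant covers the uniform bound `2 + 4 · 3/2 + 9/4` times `B`.
  refine ⟨14 * B, by positivity, fun u ε hu hε hb hl => ?_⟩
  have hWi : Integrable (fun m : Chord n => gagliardoDensity α u m.1) (chordMeasure n) :=
    (integrable_gagliardoDensity hn hα0 hα1 hu.measurable hl).comp_fst _
  have hWe : ∫ m : Chord n, gagliardoDensity α u m.1 ∂(chordMeasure n) =
      gagliardoSq ((1 + α) / 2) u := by
    rw [gagliardoSq_eq, integral_fun_fst]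
    simp
  set W : Chord n → ℝ := fun m => gagliardoDensity α u m.1 with hW
  have hW0 : ∀ m, 0 ≤ W m := fun m => gagliardoDensity_nonneg α u m.1
  set e : Chord n → ℝ × ℝ × ℝ := chordVector u with he
  have hebd : ∀ m, |(e m).1| ≤ 1 / 2 ∧ |(e m).2.1| ≤ 1 / 2 ∧ |(e m).2.2| ≤ 1 := fun m => by
    obtain ⟨h1, h2, h3⟩ := abs_chordVector_le hb hl m
    exact ⟨h1.trans hε, h2.trans hε, h3.trans (by linarith)⟩
  have hen : ∀ m, ‖e m‖ ≤ 2 * ε := norm_chordVector_le hb hl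
  have hK := fun m => hBb (e m) (hebd m).1 (hebd m).2.1 (hebd m).2.2
  have hG0 : ∀ m, ∀ t ∈ Ioo (-(3 / 2) : ℝ) (3 / 2), |modelKernel n α (t • e m)| ≤ B :=
    fun m t ht => (hK m t ht).2.2.1
  have hG1 : ∀ m, ∀ t ∈ Ioo (-(3 / 2) : ℝ) (3 / 2), |G₁ t (e m)| ≤ B * (2 * ε) := fun m t ht =>
    (hK m t ht).2.2.2.1.trans (mul_le_mul_of_nonneg_left (hen m) hB)
  have hG2 : ∀ m, ∀ t ∈ Ioo (-(3 / 2) : ℝ) (3 / 2), |G₂ t (e m)| ≤ B * (2 * ε) := fun m t ht => by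
    -- As `‖e‖ ≤ 2ε ≤ 1`, the quadratic bound on `G₂` is weakened to a linear one.
    refine (hK m t ht).2.2.2.2.trans (mul_le_mul_of_nonneg_left ?_ hB)
    have := hen m
    have := norm_nonneg (e m)
    nlinarith
  have hG1' : ∀ m, ∀ t ∈ Ioo (-(3 / 2) : ℝ) (3 / 2), |G₁ t (e m)| ≤ B := fun m t ht =>
    (hG1 m t ht).trans (mul_le_of_le_one_right hB (by linarith))
  have hG2' : ∀ m, ∀ t ∈ Ioo (-(3 / 2) : ℝ) (3 / 2), |G₂ t (e m)| ≤ B := fun m t ht =>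
    (hG2 m t ht).trans (mul_le_of_le_one_right hB (by linarith))
  have ht1 : ∀ t ∈ Ioo (-(3 / 2) : ℝ) (3 / 2), |t| ≤ 3 / 2 := fun t ht =>
    abs_le.2 ⟨ht.1.le, ht.2.le⟩
  have ht2 : ∀ t ∈ Ioo (-(3 / 2) : ℝ) (3 / 2), |t ^ 2| ≤ 9 / 4 := fun t ht => by
    rw [abs_pow]
    refine (pow_le_pow_left₀ (abs_nonneg _) (ht1 t ht) 2).trans ?_
    norm_num
  have hprod : ∀ {a b c d : ℝ}, |a| ≤ c → |b| ≤ d → |a * b| ≤ c * d := fun {a b c d} h1 h2 => by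
    rw [abs_mul]
    exact mul_le_mul h1 h2 (abs_nonneg _) ((abs_nonneg _).trans h1)
  have hWb : ∀ {a c : ℝ} (m), |a| ≤ c → |a * W m| ≤ c * W m := fun {a c} m h => by
    rw [abs_mul, abs_of_nonneg (hW0 m)]
    exact mul_le_mul_of_nonneg_right h (hW0 m)
  have h2b : ∀ t ∈ Ioo (-(3 / 2) : ℝ) (3 / 2), ∀ m, |(2 * modelKernel n α (t • e m) +
      4 * t * G₁ t (e m) + t ^ 2 * G₂ t (e m)) * W m| ≤ 14 * B * W m := fun t ht m => by
    refine hWb m ((abs_add_three _ _ _).trans ?_)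
    have a0 := hprod (abs_two (α := ℝ)).le (hG0 m t ht)
    have a1 := hprod (hprod (show |(4 : ℝ)| ≤ 4 by norm_num) (ht1 t ht)) (hG1' m t ht)
    have a2 := hprod (ht2 t ht) (hG2' m t ht)
    linarith
  have key := fun t (ht : t ∈ Ioo (-(3 / 2) : ℝ) (3 / 2)) => hasDerivAt_integral_twice
    (μ := chordMeasure n) (F := fun t m => t ^ 2 * modelKernel n α (t • e m) * W m)
    (F' := fun t m => (2 * t * modelKernel n α (t • e m) + t ^ 2 * G₁ t (e m)) * W m)
    (F'' := fun t m => (2 * modelKernel n α (t • e m) + 4 * t * G₁ t (e m) +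
      t ^ 2 * G₂ t (e m)) * W m)
    (b := fun m => 14 * B * W m) isOpen_Ioo (hWi.const_mul _)
    (fun t _ => by
      have := measurable_modelKernel n α
      have := measurable_chordVector hu.measurable
      have := measurable_gagliardoDensity α hu.measurable
      fun_prop)
    (fun t ht m => (((hasDerivAt_pow 2 t).mul (hK m t ht).1).mul_const (W m)).congr_deriv
      (by norm_num))
    (fun t ht m => (((((hasDerivAt_id t).const_mul 2).mul (hK m t ht).1).add
      ((hasDerivAt_pow 2 t).mul (hK m t ht).2.1)).mul_const (W m)).congr_deriv
      (by simp only [id]; push_cast; ring))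
    (fun t ht m => hWb m (by
      have a0 := hprod (ht2 t ht) (hG0 m t ht)
      linarith))
    (fun t ht m => hWb m (by
      refine (abs_add_le _ _).trans ?_
      have a0 := hprod (hprod (abs_two (α := ℝ)).le (ht1 t ht)) (hG0 m t ht)
      have a1 := hprod (ht2 t ht) (hG1' m t ht)
      linarith))
    h2b ht
  refine ⟨_, _, fun t ht => ⟨(key t ht).1, (key t ht).2.2.1, (key t ht).2.2.2, ?_⟩, ?_⟩
  · rw [← hWe]
    exact abs_integral_le_const_mul hWi (h2b t ht)
  · have m1 : (1 : ℝ) ∈ Ioo (-(3 / 2) : ℝ) (3 / 2) := by norm_num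
    rw [← hWe, ← integral_sub (key 1 m1).2.1 (key 0 (by norm_num)).2.1]
    refine abs_integral_le_const_mul hWi fun m => ?_
    -- Mean value inequality: the kernel itself moves by at most `2 B ε` between `t = 0` and `t =
    -- 1`. The other terms of the second derivative carry a factor `t` or `t²`, so they vanish at
    -- `0` and are `O(ε)` at `1`.
    have hG := norm_image_sub_le_of_norm_deriv_le_segment_01'
      (f := fun t : ℝ => modelKernel n α (t • e m)) (f' := fun t => G₁ t (e m))
      (C := B * (2 * ε))
      (fun t ht => (hK m t ⟨by linarith [ht.1], by linarith [ht.2]⟩).1.hasDerivWithinAt)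
      (fun t ht => hG1 m t ⟨by linarith [ht.1], by linarith [ht.2]⟩)
    rw [Real.norm_eq_abs] at hG
    have eq : (2 * modelKernel n α ((1 : ℝ) • e m) + 4 * 1 * G₁ 1 (e m) +
        1 ^ 2 * G₂ 1 (e m)) * W m -
        (2 * modelKernel n α ((0 : ℝ) • e m) + 4 * 0 * G₁ 0 (e m) + 0 ^ 2 * G₂ 0 (e m)) * W m =
        (2 * (modelKernel n α ((1 : ℝ) • e m) - modelKernel n α ((0 : ℝ) • e m)) +
          4 * G₁ 1 (e m) + G₂ 1 (e m)) * W m := by ring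
    rw [eq]
    refine hWb m ((abs_add_three _ _ _).trans ?_)
    have a0 := hprod (abs_two (α := ℝ)).le hG
    have a1 := hprod (show |(4 : ℝ)| ≤ 4 by norm_num) (hG1 m 1 m1)
    have a2 := hG2 m 1 m1
    linarith

theorem sobolevNorm_sq {n : ℕ} (α : ℝ) (u : Sph n → ℝ) :
    sobolevNorm ((1 + α) / 2) u ^ 2 =
      (∫ x, u x ^ 2 ∂(surfaceMeasure n)) + gagliardoSq ((1 + α) / 2) u := by
  refine Real.sq_sqrt (add_nonneg (integral_nonneg fun x => sq_nonneg _) ?_)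
  rw [gagliardoSq_eq]
  exact integral_nonneg (gagliardoDensity_nonneg α u)

/-- The second derivative of the perimeter along a line of nearly spherical sets, with its bounds
in terms of the `H^{(1 + α) / 2}` norm. -/
theorem exists_hasDerivAt_perimeterOf {n : ℕ} (hn : 2 ≤ n) {α : ℝ} (hα0 : 0 < α) (hα1 : α < 1) :
    ∃ C : ℝ, 0 < C ∧ ∀ (u : Sph n → ℝ) (ε : ℝ), Continuous u → 0 ≤ ε → ε ≤ 1 / 2 →
      (∀ x, |u x| ≤ ε) → (∀ x y, |u x - u y| ≤ 2 * ε * ‖(x : Space n) - y‖) →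
      ∃ p₁ p₂ : ℝ → ℝ, (∀ t ∈ Ioo (-(3 / 2) : ℝ) (3 / 2),
        perimeter α (nearlySpherical (t • u)) ≠ ∞ ∧
        HasDerivAt (fun t : ℝ => perimeterOf α (t • u)) (p₁ t) t ∧ HasDerivAt p₁ (p₂ t) t ∧
        |p₂ t| ≤ C * sobolevNorm ((1 + α) / 2) u ^ 2) ∧
        |p₂ 1 - p₂ 0| ≤ C * ε * sobolevNorm ((1 + α) / 2) u ^ 2 := by
  have hn0 : n ≠ 0 := by omega
  obtain ⟨CΦ, -, hΦ⟩ := exists_toReal_spherePotential_le hn0 hα0 hα1 (n := n)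
  obtain ⟨C₁, hC₁, h₁⟩ := exists_hasDerivAt_integral_rpow (surfaceMeasure n) ((n : ℝ) - α)
    (measurable_spherePotential α).ennreal_toReal (fun _ => ENNReal.toReal_nonneg)
    (fun x => (hΦ x).2)
  obtain ⟨C₂, hC₂, h₂⟩ := exists_hasDerivAt_integral_chord hn hα0 hα1
  -- The summand `1` only serves to make the constant strictly positive.
  refine ⟨C₁ + C₂ + 1, by positivity, fun u ε hu hε0 hε hb hl => ?_⟩
  obtain ⟨a₁, a₂, ha, had⟩ := h₁ u ε hu.measurable hε hb
  obtain ⟨b₁, b₂, hb', hbd⟩ := h₂ u ε hu hε hb hl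
  have hU : 0 ≤ ∫ x, u x ^ 2 ∂(surfaceMeasure n) := integral_nonneg fun x => sq_nonneg _
  have hS : 0 ≤ gagliardoSq ((1 + α) / 2) u := by
    rw [gagliardoSq_eq]
    exact integral_nonneg (gagliardoDensity_nonneg α u)
  have hper := fun t (ht : t ∈ Ioo (-(3 / 2) : ℝ) (3 / 2)) =>
    perimeterOf_smul_eq hn0 hα0 hα1 hu hb hε ht (ha t ht).1 (hb' t ht).1 fun m => by
      obtain ⟨e1, e2, -⟩ := abs_chordVector_le hb hl m
      exact modelKernel_nonneg (e1.trans hε) (e2.trans hε) ht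
  rw [sobolevNorm_sq]
  have hsum : ∀ {A B X Y c : ℝ}, 0 ≤ X → 0 ≤ Y → 0 ≤ c → |A| ≤ C₁ * c * X → |B| ≤ C₂ * c * Y →
      |A + 1 / 2 * B| ≤ (C₁ + C₂ + 1) * c * (X + Y) := by
    intro A B X Y c hX hY hc hA hB
    have h3 := abs_add_le A (1 / 2 * B)
    rw [abs_mul, abs_of_pos (show (0 : ℝ) < 1 / 2 by norm_num)] at h3
    have i1 : 0 ≤ C₁ * c * Y := by positivity
    have i2 : 0 ≤ C₂ * c * X := by positivity
    have i3 : 0 ≤ C₂ * c * Y := by positivity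
    have i4 : 0 ≤ c * (X + Y) := by positivity
    linarith
  refine ⟨fun t => a₁ t + 1 / 2 * b₁ t, fun t => a₂ t + 1 / 2 * b₂ t,
    fun t ht => ⟨(hper t ht).1, ?_, ?_, ?_⟩, ?_⟩
  · refine ((ha t ht).2.1.add ((hb' t ht).2.1.const_mul (1 / 2))).congr_of_eventuallyEq ?_
    filter_upwards [isOpen_Ioo.mem_nhds ht] with s hs using (hper s hs).2
  · exact (ha t ht).2.2.1.add ((hb' t ht).2.2.1.const_mul (1 / 2))
  · have := hsum (c := 1) hU hS zero_le_one (by simpa using (ha t ht).2.2.2)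
      (by simpa using (hb' t ht).2.2.2)
    simpa using this
  · have e : a₂ 1 + 1 / 2 * b₂ 1 - (a₂ 0 + 1 / 2 * b₂ 0) =
        (a₂ 1 - a₂ 0) + 1 / 2 * (b₂ 1 - b₂ 0) := by ring
    rw [e]
    exact hsum hU hS hε0 had hbd

end FracPerimeter

end

theorem proposition5p1 (n : ℕ) (hn : 2 ≤ n) (α : ℝ) (hα0 : 0 < α) (hα1 : α < 1) :
    ∃ C : ℝ, 0 < C ∧
      ∀ u : FracPerimeter.Sph n → ℝ, FracPerimeter.IsC1 u → FracPerimeter.c1Norm u < 1 / 2 →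
        (FracPerimeter.HasSecondVariation α u u u ∧
          FracPerimeter.HasSecondVariation α 0 u u ∧
          |FracPerimeter.secondVariation α u u u - FracPerimeter.secondVariation α 0 u u| ≤
            C * FracPerimeter.c1Norm u * FracPerimeter.sobolevNorm ((1 + α) / 2) u ^ 2) ∧
        ∀ l : ℝ, |l| ≤ 1 →
          FracPerimeter.HasSecondVariation α (l • u) u u ∧
          |FracPerimeter.secondVariation α (l • u) u u| ≤
            C * FracPerimeter.sobolevNorm ((1 + α) / 2) u ^ 2 := by
  obtain ⟨C, hC, h⟩ := FracPerimeter.exists_hasDerivAt_perimeterOf hn hα0 hα1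
  refine ⟨C, hC, fun u hu hu2 => ?_⟩
  obtain ⟨p₁, p₂, hp, hd⟩ := h u (FracPerimeter.c1Norm u) hu.continuous
    (FracPerimeter.c1Norm_nonneg u) hu2.le hu.abs_le_c1Norm hu.abs_sub_le
  have key := fun l (hl : l ∈ Ioo (-(3 / 2) : ℝ) (3 / 2)) =>
    FracPerimeter.hasSecondVariation_of_hasDerivAt (fun t ht => (hp t ht).1)
      (fun t ht => (hp t ht).2.1) (fun t ht => (hp t ht).2.2.1) hl
  have k1 := key 1 (by norm_num)
  have k0 := key 0 (by norm_num)
  rw [one_smul] at k1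
  rw [zero_smul] at k0
  refine ⟨⟨k1.1, k0.1, ?_⟩, fun l hl => ?_⟩
  · rw [k1.2, k0.2]
    exact hd
  · have hl' : l ∈ Ioo (-(3 / 2) : ℝ) (3 / 2) :=
      ⟨by linarith [(abs_le.1 hl).1], by linarith [(abs_le.1 hl).2]⟩
    refine ⟨(key l hl').1, ?_⟩
    rw [(key l hl').2]
    exact (hp l hl').2.2.2
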